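/- **Model.** A platform with $L$ drivers serves riders. A state is $(l,m)\in\mathcal S=\{0,\dots,L\}\times\mathbb Z_{\ge 0}$: $l$ drivers are in service and $m$ riders wait in the queue. Potential riders arrive at rate $\Lambda>0$. A rider's willingness to pay per kilometer has distribution function $F$, and $\bar F=1-F$ is strictly decreasing on $[0,p_{\max}]$ with $\bar F(0)=1$, $\bar F(p_{\max})=0$; the map $p\mapsto\Lambda\bar F(p)$ is a bijection of $[0,p_{\max}]$ onto $[0,\Lambda]$, with inverse $p_1(\cdot)$. Each driver in service at $(l,m)$ completes the trip at rate $\mu_{l,m}$, where $\mu_{l,m}>0$ for $l\ge 1$ and $\mu_{l,m}\le\bar\mu$ for some constant $\bar\mu>0$. The base fare is $p_0\ge0$ and the mean on-trip time is $t_0>0$. The positive constants $w^d_s,w^d_o,w^r_p,w^r_q$ are the costs per unit time of a driver in service, an idle driver, a rider waiting for pick-up and a rider waiting in the queue. Put $c_d=w^d_s+w^r_p-w^d_o$ and $c_r=w^r_q$. A policy is a pair $(\lambda,\phi)$ with $\lambda:\mathcal S\to[0,\Lambda]$ (effective request rate) and $\phi:\mathcal S\to\{0,1\}$ ($1$ =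 dispatch, $0$ = hold), where $\phi(l,0)=0$ and $\phi(L,m)=0$ for all $l,m$. Whenever $\phi(l,m)=1$, the state moves instantly to $(l+1,m-1)$, and this is repeated until a state with $\phi=0$ is reached. In a state $(l,m)$ with $\phi(l,m)=0$, the state moves to $(l,m+1)$ at rate $\lambda(l,m)$ and to $(l-1,m)$ at rate $l\mu_{l,m}$, each move followed by the dispatches that $\phi$ prescribes. The net reward rate at $(l,m)$ is $\lambda(l,m)\bigl(p_0+w^r_pt_0+p_1(\lambda(l,m))\,t_0\bigr)-c_dl-c_rm$. A policy is *optimal* if, from every initial state, its long-run average expected net reward $\lim_{T\to\infty}\frac1T\mathbb E[\text{net reward on }[0,T]]$ exists and is at least the corresponding upper limit for every other policy. A state $(l,m)$ is of *type 1* if $l=L$, or $m=0$, or $l\mu_{l,m}>(l+1)\mu_{l+1,m-1}$; otherwise it is of *type 2*. A dispatching policy $\phi$ is *zigzag* if for each $l$ the sequence $(\phi(l,m))_{m\ge 0}$ is non-decreasing, and for each $m$ the sequence $(\phi(l,m))_{0\le l\le L}$ is non-increasing. **Theorem (optimal dispatching policy).** Assume diminishing returns on $\mathcal S$: (1) $l\mu_{l,m+1}-l\mu_{l,m}$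 is non-increasing in $m$ and non-decreasing in $l$; (2) $(l+1)\mu_{l+1,m}-l\mu_{l,m}$ is non-increasing in $l$ and non-decreasing in $m$. 1. If $c_d=c_r$, there is an optimal policy $(\lambda^*,\phi^*)$ with $\phi^*(l,m)=0$ at every type 1 state and $\phi^*(l,m)=1$ at every type 2 state; this $\phi^*$ is zigzag. 2. If $c_d>c_r$, there is an optimal policy $(\lambda^*,\phi^*)$ with $\phi^*(l,m)=0$ at every type 1 state. 3. If $0\le c_d<c_r$, there is an optimal policy $(\lambda^*,\phi^*)$ with $\phi^*(l,m)=1$ at every type 2 state. -/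

import Mathlib

noncomputable section

namespace SpatialQueue

open Set Filter Topology MeasureTheory ProbabilityTheory

/-- The data of the two-sided spatial queue. A state is a pair `(l, m)` with `l ≤ L` drivers in
service and `m` riders waiting in the queue; functions of the state are written as functions on
`ℕ × ℕ`, and only their values at `l ≤ L` matter. -/
structure Model where
  /-- number of drivers -/
  L : ℕ
  /-- rate of the Poisson stream of potential riders -/
  Lam : ℝ
  Lam_pos : 0 < Lam
  /-- service rate `μ_{l,m}` of each driver in service at state `(l, m)` -/
  mu : ℕ → ℕ → ℝ
  mu_pos : ∀ l m, 1 ≤ l → l ≤ L → 0 < mu l m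
  /-- uniform bound on the service rates -/
  muBar : ℝ
  muBar_pos : 0 < muBar
  mu_le : ∀ l m, l ≤ L → mu l m ≤ muBar
  /-- law of the riders' willingness to pay per kilometer -/
  wtp : Measure ℝ
  wtp_prob : IsProbabilityMeasure wtp
  /-- largest per-kilometer price -/
  pMax : ℝ
  tail_zero : 1 - cdf wtp 0 = 1
  tail_pMax : 1 - cdf wtp pMax = 0
  tail_strictAnti : StrictAntiOn (fun p => 1 - cdf wtp p) (Icc 0 pMax)
  /-- one-to-one correspondence between prices and effective request rates -/
  price_bij : BijOn (fun p => Lam * (1 - cdf wtp p)) (Icc 0 pMax) (Icc 0 Lam)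
  /-- fixed base fare -/
  p0 : ℝ
  p0_nonneg : 0 ≤ p0
  /-- mean on-trip time -/
  t0 : ℝ
  t0_pos : 0 < t0
  /-- cost per unit time of a driver in service -/
  wsd : ℝ
  wsd_pos : 0 < wsd
  /-- cost per unit time of an idle driver -/
  wod : ℝ
  wod_pos : 0 < wod
  /-- penalty per unit time of a rider waiting to be picked up -/
  wpr : ℝ
  wpr_pos : 0 < wpr
  /-- penalty per unit time of a rider waiting in the queue -/
  wqr : ℝ
  wqr_pos : 0 < wqr

namespace Model

variable (M : Model)

/-- Driver-side penalty coefficient `c_d`. -/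
def cd : ℝ := M.wsd + M.wpr - M.wod

/-- Rider-side penalty coefficient `c_r`. -/
def cr : ℝ := M.wqr

/-- Total trip completion rate `l * μ_{l,m}`. -/
def totalRate (l m : ℕ) : ℝ := (l : ℝ) * M.mu l m

/-- The per-kilometer price at which the effective request rate is `lam`. -/
def price (lam : ℝ) : ℝ :=
  Function.invFunOn (fun p => M.Lam * (1 - cdf M.wtp p)) (Icc 0 M.pMax) lam

/-- A clock rate that dominates the total transition rate at every state. -/
def clock : ℝ := M.Lam + M.L * M.muBar

/-- The diminishing-returns conditions on the total service rate. -/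
def DiminishingReturns : Prop :=
  ((∀ l ≤ M.L, Antitone fun m => M.totalRate l (m + 1) - M.totalRate l m) ∧
    (∀ m, MonotoneOn (fun l => M.totalRate l (m + 1) - M.totalRate l m) (Iic M.L))) ∧
  ((∀ m, AntitoneOn (fun l => M.totalRate (l + 1) m - M.totalRate l m) (Iio M.L)) ∧
    (∀ l < M.L, Monotone fun m => M.totalRate (l + 1) m - M.totalRate l m))

/-- Type 1 states: dispatching one driver is impossible or strictly lowers the total rate. -/
def IsType1 (l m : ℕ) : Prop :=
  l ≤ M.L ∧ (l = M.L ∨ m = 0 ∨ M.totalRate (l + 1) (m - 1) < M.totalRate l m)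

/-- Type 2 states: all the other states. -/
def IsType2 (l m : ℕ) : Prop :=
  l ≤ M.L ∧ ¬ M.IsType1 l m

end Model

/-- A policy: a pricing policy, given by the effective request rates, together with a dispatching
policy (`1` is dispatch, `0` is hold), which can only dispatch when there are an idle driver and a
waiting rider. -/
structure Policy (M : Model) where
  rate : ℕ → ℕ → ℝ
  rate_mem : ∀ l m, l ≤ M.L → rate l m ∈ Icc 0 M.Lam
  dispatch : ℕ → ℕ → Fin 2
  dispatch_no_rider : ∀ l, dispatch l 0 = 0
  dispatch_no_driver : ∀ m, dispatch M.L m = 0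

/-- The state reached from `(l, m)` by dispatching drivers one at a time until the dispatching
policy `φ` says hold. -/
def settle (φ : ℕ → ℕ → Fin 2) : ℕ → ℕ → ℕ × ℕ
  | l, 0 => (l, 0)
  | l, m + 1 => if φ l (m + 1) = 1 then settle φ (l + 1) m else (l, m + 1)

namespace Policy

variable {M : Model} (P : Policy M)

/-- One tick of the uniformized chain, acting on functions of the state: at state `(l, m)` a rider
joins at rate `λ(l, m)`, a trip is completed at rate `l * μ_{l,m}`, each followed by the
dispatches that the policy prescribes. -/
def step (f : ℕ × ℕ → ℝ) (x : ℕ × ℕ) : ℝ :=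
  f x + P.rate x.1 x.2 / M.clock * (f (settle P.dispatch x.1 (x.2 + 1)) - f x)
    + M.totalRate x.1 x.2 / M.clock * (f (settle P.dispatch (x.1 - 1) x.2) - f x)

/-- `E_x[f(X_t)]` for the continuous-time Markov chain `X` controlled by the policy: the number of
ticks up to time `t` is Poisson with mean `clock * t`. -/
def expect (f : ℕ × ℕ → ℝ) (t : ℝ) (x : ℕ × ℕ) : ℝ :=
  ∑' k : ℕ, Real.exp (-(M.clock * t)) * (M.clock * t) ^ k / (k.factorial : ℝ) * (P.step^[k] f) x

/-- Net reward rate at a state: revenue rate minus driver-side and rider-side penalty rates. -/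
def reward (x : ℕ × ℕ) : ℝ :=
  P.rate x.1 x.2 * (M.p0 + M.wpr * M.t0 + M.price (P.rate x.1 x.2) * M.t0)
    - M.cd * x.1 - M.cr * x.2

/-- Expected net reward per unit time over `[0, T]` when the system is started at `(l, m)`
(and the dispatches prescribed there are carried out at once). -/
def avgReward (T : ℝ) (l m : ℕ) : ℝ :=
  (∫ t in (0 : ℝ)..T, P.expect P.reward t (settle P.dispatch l m)) / T

/-- A policy is optimal if from every initial state its long-run average net reward exists and is
at least the (upper) long-run average net reward of every other policy. -/
def IsOptimal : Prop :=
  ∃ g : ℕ → ℕ → ℝ, ∀ l m, l ≤ M.L →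
    Tendsto (fun T => P.avgReward T l m) atTop (𝓝 (g l m)) ∧
    ∀ Q : Policy M, limsup (fun T => ((Q.avgReward T l m : ℝ) : EReal)) atTop ≤ (g l m : EReal)

/-- Zigzag dispatching: each row `φ(l, ·)` consists of `0`s followed by `1`s, and each column
`φ(·, m)` of `1`s followed by `0`s. -/
def IsZigzag : Prop :=
  (∀ l ≤ M.L, Monotone fun m => P.dispatch l m) ∧
  (∀ m, AntitoneOn (fun l => P.dispatch l m) (Iic M.L))

end Policy

end SpatialQueue

end

open Set Filter Topology MeasureTheory ProbabilityTheory

noncomputable section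

namespace SpatialQueue

/-! ### Prices, revenue and the value of an arrival -/

namespace Model

variable (M : Model)

/-! The proof is a vanishing-discount argument for the uniformized chain, in which dispatching is an
instantaneous alternative to holding in the Bellman operator.

For a discount rate `β` and a penalty truncated at `K`, value iteration from a subsolution increases
to a fixed point `V` (`exists_isValue`). The structure comes from coupling completion ticks. `V`
decreases in the number of busy drivers. If a dispatch does not lower the total rate and `c_d ≤
c_r`, dispatching loses nothing (`hold_le_hold_dispatch`). If it lowers the rate and `c_r ≤ c_d`,
holding loses nothing (`hold_dispatch_le_hold`). Diminishing returns make the type 2 states closed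
under adding a rider and freeing a driver, so these comparisons reproduce themselves along the
transitions.

As `β → 0` and `K → ∞`, the relative values `V l m - V 0 0` stay bounded at each state, with an
upper bound uniform over all states (`exists_lower_bound`, `exists_uniform_upper_bound`). A limit
along an ultrafilter gives a gain `g` and relative values `h` (`exists_isAverageSolution`). At each
state either the holding equation or the dispatching equation survives, and the structural facts say
which one may be used.

Optimality has two halves with different certificates. No policy beats `g`: each discounted `V` is
bounded, and truncating the penalty only raises the reward, so `V` bounds every policy by `β * (V 0
0 + C)`, which tends to `g`. The greedy policy attains `g`: it uses only valid equations for `h`,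
and `h` is bounded above, which is all that a lower bound on the reward requires
(`isOptimal_greedyPolicy`). The three cases differ only in how ties between the two equations are
broken.

With no drivers the queue never drains and the gain depends on the initial queue, so that case is
settled directly. -/

theorem price_mem {x : ℝ} (hx : x ∈ Icc 0 M.Lam) : M.price x ∈ Icc 0 M.pMax :=
  Function.invFunOn_mem (M.price_bij.surjOn hx)

theorem Lam_mul_tail_price {x : ℝ} (hx : x ∈ Icc 0 M.Lam) :
    M.Lam * (1 - cdf M.wtp (M.price x)) = x :=
  Function.invFunOn_eq (f := fun p => M.Lam * (1 - cdf M.wtp p)) (M.price_bij.surjOn hx)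

theorem price_Lam_mul_tail {p : ℝ} (hp : p ∈ Icc 0 M.pMax) :
    M.price (M.Lam * (1 - cdf M.wtp p)) = p :=
  M.price_bij.injOn (M.price_mem (M.price_bij.mapsTo hp)) hp
    (M.Lam_mul_tail_price (M.price_bij.mapsTo hp))

theorem price_antitoneOn : AntitoneOn M.price (Icc 0 M.Lam) := by
  intro x hx y hy hxy
  by_contra! h
  have h1 := M.tail_strictAnti (M.price_mem hx) (M.price_mem hy) h
  have h2 := mul_lt_mul_of_pos_left h1 M.Lam_pos
  simp only [M.Lam_mul_tail_price hx, M.Lam_mul_tail_price hy] at h2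
  linarith

/-- A monotone surjection between these intervals has no jumps. The order dual turns the decreasing
price map into an increasing one. -/
theorem continuousOn_price : ContinuousOn M.price (Icc 0 M.Lam) := by
  let f : Icc 0 M.Lam → (Icc 0 M.pMax)ᵒᵈ :=
    fun x => OrderDual.toDual ⟨M.price x, M.price_mem x.2⟩
  have hmono : Monotone f := fun x y hxy => M.price_antitoneOn x.2 y.2 hxy
  have hsurj : Function.Surjective f := fun p =>
    ⟨⟨_, M.price_bij.mapsTo (OrderDual.ofDual p).2⟩,
      Subtype.ext (M.price_Lam_mul_tail (OrderDual.ofDual p).2)⟩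
  have hf : Continuous f := hmono.continuous_of_surjective hsurj
  rw [continuousOn_iff_continuous_domRestrict]
  exact continuous_subtype_val.comp (continuous_ofDual.comp hf)

theorem pMax_nonneg : 0 ≤ M.pMax :=
  have h := M.price_mem ⟨le_rfl, M.Lam_pos.le⟩
  h.1.trans h.2

/-- Revenue rate, with the pick-up credit, at effective request rate `x`. -/
def revenue (x : ℝ) : ℝ := x * (M.p0 + M.wpr * M.t0 + M.price x * M.t0)

/-- The largest revenue per rider. -/
def maxFare : ℝ := M.p0 + M.wpr * M.t0 + M.pMax * M.t0

theorem maxFare_nonneg : 0 ≤ M.maxFare := by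
  have h0 := M.p0_nonneg
  have h1 := mul_pos M.wpr_pos M.t0_pos
  have h2 := mul_nonneg M.pMax_nonneg M.t0_pos.le
  unfold maxFare
  linarith

theorem continuousOn_revenue : ContinuousOn M.revenue (Icc 0 M.Lam) :=
  continuousOn_id.mul (continuousOn_const.add (M.continuousOn_price.mul continuousOn_const))

theorem revenue_nonneg {x : ℝ} (hx : x ∈ Icc 0 M.Lam) : 0 ≤ M.revenue x := by
  have h0 := M.p0_nonneg
  have h1 := mul_pos M.wpr_pos M.t0_pos
  have h2 := mul_nonneg (M.price_mem hx).1 M.t0_pos.le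
  exact mul_nonneg hx.1 (by linarith)

theorem revenue_le {x : ℝ} (hx : x ∈ Icc 0 M.Lam) : M.revenue x ≤ M.maxFare * x := by
  have h2 := mul_le_mul_of_nonneg_right (M.price_mem hx).2 M.t0_pos.le
  unfold revenue maxFare
  rw [mul_comm]
  exact mul_le_mul_of_nonneg_right (by linarith) hx.1

/-- Upper bound on the revenue rate. -/
def maxRevenue : ℝ := M.maxFare * M.Lam

theorem maxRevenue_nonneg : 0 ≤ M.maxRevenue := mul_nonneg M.maxFare_nonneg M.Lam_pos.le

theorem revenue_le_max {x : ℝ} (hx : x ∈ Icc 0 M.Lam) : M.revenue x ≤ M.maxRevenue :=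
  (M.revenue_le hx).trans (mul_le_mul_of_nonneg_left hx.2 M.maxFare_nonneg)

theorem exists_optRate (a b : ℝ) : ∃ x ∈ Icc 0 M.Lam, ∀ y ∈ Icc 0 M.Lam,
    M.revenue y + y * a + (M.Lam - y) * b ≤ M.revenue x + x * a + (M.Lam - x) * b := by
  have hc : ContinuousOn (fun y => M.revenue y + y * a + (M.Lam - y) * b) (Icc 0 M.Lam) :=
    (M.continuousOn_revenue.add (by fun_prop)).add (by fun_prop)
  obtain ⟨x, hx, h⟩ := isCompact_Icc.exists_isMaxOn ⟨0, le_rfl, M.Lam_pos.le⟩ hc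
  exact ⟨x, hx, fun y hy => h hy⟩

/-- A request rate that is optimal when the value is `a` after an arrival and `b` otherwise. -/
def optRate (a b : ℝ) : ℝ := (M.exists_optRate a b).choose

theorem optRate_mem (a b : ℝ) : M.optRate a b ∈ Icc 0 M.Lam := (M.exists_optRate a b).choose_spec.1

/-- The best revenue plus continuation value of an arrival tick. -/
def arrivalValue (a b : ℝ) : ℝ :=
  M.revenue (M.optRate a b) + M.optRate a b * a + (M.Lam - M.optRate a b) * b

theorem le_arrivalValue {x : ℝ} (hx : x ∈ Icc 0 M.Lam) (a b : ℝ) :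
    M.revenue x + x * a + (M.Lam - x) * b ≤ M.arrivalValue a b :=
  (M.exists_optRate a b).choose_spec.2 x hx

theorem arrivalValue_mono {a a' b b' : ℝ} (ha : a ≤ a') (hb : b ≤ b') :
    M.arrivalValue a b ≤ M.arrivalValue a' b' := by
  have hx := M.optRate_mem a b
  refine le_trans ?_ (M.le_arrivalValue hx a' b')
  have h1 := mul_le_mul_of_nonneg_left ha hx.1
  have h2 := mul_le_mul_of_nonneg_left hb (sub_nonneg.2 hx.2)
  unfold arrivalValue
  linarith

theorem arrivalValue_add_le (a b c : ℝ) :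
    M.arrivalValue (a + c) (b + c) ≤ M.arrivalValue a b + M.Lam * c := by
  have h := M.le_arrivalValue (M.optRate_mem (a + c) (b + c)) a b
  have : M.arrivalValue (a + c) (b + c) = M.revenue (M.optRate (a + c) (b + c))
    + M.optRate (a + c) (b + c) * a + (M.Lam - M.optRate (a + c) (b + c)) * b + M.Lam * c := by
      rw [arrivalValue]; ring
  linarith

/-- The weights of the two continuation values always add up to `Lam`. The reverse inequality is the
first one applied to `-c`. -/
theorem arrivalValue_add (a b c : ℝ) :
    M.arrivalValue (a + c) (b + c) = M.arrivalValue a b + M.Lam * c := by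
  refine le_antisymm (M.arrivalValue_add_le a b c) ?_
  have h := M.arrivalValue_add_le (a + c) (b + c) (-c)
  simp only [add_neg_cancel_right] at h
  linarith

theorem continuous_arrivalValue : Continuous fun p : ℝ × ℝ => M.arrivalValue p.1 p.2 := by
  refine (LipschitzWith.of_le_add_mul ⟨M.Lam, M.Lam_pos.le⟩ fun p q => ?_).continuous
  have h1 : p.1 ≤ q.1 + dist p q := by
    have := (Real.dist_eq p.1 q.1 ▸ le_abs_self (p.1 - q.1)).trans (le_max_left _ (dist p.2 q.2))
    rw [Prod.dist_eq]; linarith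
  have h2 : p.2 ≤ q.2 + dist p q := by
    have := (Real.dist_eq p.2 q.2 ▸ le_abs_self (p.2 - q.2)).trans (le_max_right (dist p.1 q.1) _)
    rw [Prod.dist_eq]; linarith
  exact (M.arrivalValue_mono h1 h2).trans_eq (M.arrivalValue_add _ _ _)

theorem arrivalValue_le (a b c : ℝ) (ha : a ≤ c) (hb : b ≤ c) :
    M.arrivalValue a b ≤ M.maxRevenue + M.Lam * c := by
  have hx := M.optRate_mem a b
  have h1 := mul_le_mul_of_nonneg_left ha hx.1
  have h2 := mul_le_mul_of_nonneg_left hb (sub_nonneg.2 hx.2)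
  have h3 := M.revenue_le_max hx
  unfold arrivalValue
  linarith

theorem Lam_mul_le_arrivalValue (a b : ℝ) : M.Lam * b ≤ M.arrivalValue a b := by
  have h := M.le_arrivalValue (x := 0) ⟨le_rfl, M.Lam_pos.le⟩ a b
  simpa [revenue] using h

theorem Lam_mul_le_arrivalValue_left (a b : ℝ) : M.Lam * a ≤ M.arrivalValue a b := by
  have hm : M.Lam ∈ Icc 0 M.Lam := ⟨M.Lam_pos.le, le_rfl⟩
  have h := M.le_arrivalValue hm a b
  have := M.revenue_nonneg hm
  linarith

/-! ### Completion rates and the shape of the type 2 region -/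

theorem totalRate_zero (m : ℕ) : M.totalRate 0 m = 0 := by simp [totalRate]

theorem totalRate_pos {l m : ℕ} (h : 1 ≤ l) (hl : l ≤ M.L) : 0 < M.totalRate l m :=
  mul_pos (by exact_mod_cast h) (M.mu_pos l m h hl)

theorem totalRate_nonneg {l : ℕ} (m : ℕ) (hl : l ≤ M.L) : 0 ≤ M.totalRate l m := by
  rcases Nat.eq_zero_or_pos l with rfl | h
  · rw [totalRate_zero]
  · exact (M.totalRate_pos h hl).le

/-- A uniform bound on the total trip completion rate. -/
def maxTotalRate : ℝ := M.L * M.muBar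

theorem totalRate_le {l : ℕ} (m : ℕ) (hl : l ≤ M.L) : M.totalRate l m ≤ M.maxTotalRate :=
  (mul_le_mul_of_nonneg_left (M.mu_le l m hl) l.cast_nonneg).trans
    (mul_le_mul_of_nonneg_right (by exact_mod_cast hl) M.muBar_pos.le)

theorem maxTotalRate_nonneg : 0 ≤ M.maxTotalRate := mul_nonneg M.L.cast_nonneg M.muBar_pos.le

theorem clock_eq : M.clock = M.Lam + M.maxTotalRate := rfl

theorem clock_pos : 0 < M.clock := add_pos_of_pos_of_nonneg M.Lam_pos M.maxTotalRate_nonneg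

/-- The gain in total rate from a dispatch decreases with the number of busy drivers. -/
theorem dispatchGain_antitone_left (h : M.DiminishingReturns) {l m : ℕ} (hl : l + 2 ≤ M.L) :
    M.totalRate (l + 2) m - M.totalRate (l + 1) (m + 1) ≤
      M.totalRate (l + 1) m - M.totalRate l (m + 1) := by
  have h1 := h.2.1 m (show l ∈ Iio M.L from by simp; omega)
    (show l + 1 ∈ Iio M.L from by simp; omega) (Nat.le_succ l)
  have h2 := h.1.2 m (show l ∈ Iic M.L from by simp; omega)
    (show l + 1 ∈ Iic M.L from by simp; omega) (Nat.le_succ l)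
  simp only [add_assoc, Nat.reduceAdd] at h1 h2
  linarith

theorem dispatchGain_monotone_right (h : M.DiminishingReturns) {l m : ℕ} (hl : l + 1 ≤ M.L) :
    M.totalRate (l + 1) m - M.totalRate l (m + 1) ≤
      M.totalRate (l + 1) (m + 1) - M.totalRate l (m + 2) := by
  have h1 := h.1.1 l (by omega) (Nat.le_succ m)
  have h2 := h.1.2 m (show l ∈ Iic M.L from by simp; omega)
    (show l + 1 ∈ Iic M.L from hl) (Nat.le_succ l)
  linarith

theorem isType2_succ_iff {l m : ℕ} (hl : l < M.L) :
    M.IsType2 l (m + 1) ↔ M.totalRate l (m + 1) ≤ M.totalRate (l + 1) m := by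
  simp only [IsType2, IsType1, Nat.add_sub_cancel]
  constructor
  · intro h
    by_contra! h'
    exact h.2 ⟨h.1, Or.inr (Or.inr h')⟩
  · intro h
    refine ⟨hl.le, fun h' => ?_⟩
    rcases h'.2 with h1 | h1 | h1
    · omega
    · omega
    · linarith

theorem IsType2.lt {M : Model} {l m : ℕ} (h : M.IsType2 l m) : l < M.L :=
  lt_of_le_of_ne h.1 fun h' => h.2 ⟨h.1, Or.inl h'⟩

theorem IsType2.pos {M : Model} {l m : ℕ} (h : M.IsType2 l m) : 0 < m :=
  Nat.pos_of_ne_zero fun h' => h.2 ⟨h.1, Or.inr (Or.inl h')⟩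

/-- With `IsType2.of_succ_left`, this makes the type 2 region closed under arrivals and completions.
That closure drives both the inductions on values and the zigzag property. -/
theorem IsType2.succ_right {M : Model} (hM : M.DiminishingReturns) {l m : ℕ}
    (h : M.IsType2 l m) : M.IsType2 l (m + 1) := by
  have hl := h.lt
  obtain ⟨m, rfl⟩ := Nat.exists_eq_succ_of_ne_zero h.pos.ne'
  rw [Nat.succ_eq_add_one, isType2_succ_iff M hl] at *
  have := M.dispatchGain_monotone_right hM (m := m) hl
  linarith

theorem IsType2.of_succ_left {M : Model} (hM : M.DiminishingReturns) {l m : ℕ}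
    (h : M.IsType2 (l + 1) m) : M.IsType2 l m := by
  have hl := h.lt
  obtain ⟨m, rfl⟩ := Nat.exists_eq_succ_of_ne_zero h.pos.ne'
  have h1 := (M.isType2_succ_iff hl).1 h
  refine (M.isType2_succ_iff (by omega)).2 ?_
  have h2 := M.dispatchGain_antitone_left hM (l := l) (m := m) (by omega)
  have h3 := M.dispatchGain_monotone_right hM (l := l) (m := m) (by omega)
  simp only [add_assoc, Nat.reduceAdd] at *
  linarith

end Model

/-! ### Poisson means and their time integrals -/

/-- Mean of `a N` for a Poisson variable `N` with mean `s`. -/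
def poissonMean (a : ℕ → ℝ) (s : ℝ) : ℝ :=
  ∑' k : ℕ, Real.exp (-s) * s ^ k / (k.factorial : ℝ) * a k

theorem summable_pow_div_factorial_mul {a : ℕ → ℝ} {A B : ℝ} (ha : ∀ k, |a k| ≤ A * B ^ k)
    (s : ℝ) : Summable fun k : ℕ => s ^ k / (k.factorial : ℝ) * a k := by
  refine Summable.of_norm_bounded ((Real.summable_pow_div_factorial (|s| * B)).mul_left A)
    fun k => ?_
  rw [Real.norm_eq_abs, abs_mul, abs_div, abs_pow, Nat.abs_cast, mul_pow]
  calc _ ≤ |s| ^ k / (k.factorial : ℝ) * (A * B ^ k) :=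
        mul_le_mul_of_nonneg_left (ha k) (by positivity)
    _ = _ := by ring

theorem poissonMean_eq (a : ℕ → ℝ) (s : ℝ) :
    poissonMean a s = Real.exp (-s) * ∑' k : ℕ, s ^ k / (k.factorial : ℝ) * a k := by
  rw [poissonMean, ← tsum_mul_left]
  exact tsum_congr fun k => by ring

theorem summable_poisson {a : ℕ → ℝ} {A B : ℝ} (ha : ∀ k, |a k| ≤ A * B ^ k) (s : ℝ) :
    Summable fun k : ℕ => Real.exp (-s) * s ^ k / (k.factorial : ℝ) * a k := by
  refine ((summable_pow_div_factorial_mul ha s).mul_left (Real.exp (-s))).congr fun k => ?_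
  ring

theorem poissonMean_mono {a b : ℕ → ℝ} {A B : ℝ} (ha : ∀ k, |a k| ≤ A * B ^ k) {A' B' : ℝ}
    (hb : ∀ k, |b k| ≤ A' * B' ^ k) (h : ∀ k, a k ≤ b k) {s : ℝ} (hs : 0 ≤ s) :
    poissonMean a s ≤ poissonMean b s :=
  (summable_poisson ha s).tsum_le_tsum (fun k => mul_le_mul_of_nonneg_left (h k) (by positivity))
    (summable_poisson hb s)

theorem hasSum_exp (s : ℝ) : HasSum (fun k : ℕ => s ^ k / (k.factorial : ℝ)) (Real.exp s) := by
  rw [Real.exp_eq_exp_ℝ]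
  exact NormedSpace.expSeries_div_hasSum_exp s

theorem poissonMean_affine (g C s : ℝ) :
    poissonMean (fun k => g * k + C) s = g * s + C := by
  have h0 := hasSum_exp s
  have h1 : HasSum (fun k : ℕ => s ^ k / (k.factorial : ℝ) * k) (s * Real.exp s) := by
    rw [← hasSum_nat_add_iff' 1]
    simp only [Finset.range_one, Finset.sum_singleton, Nat.cast_zero, mul_zero, sub_zero]
    convert! h0.mul_left s using 2 with k
    rw [Nat.factorial_succ]
    have : (k.factorial : ℝ) ≠ 0 := by positivity
    push_cast
    field_simp
    ring
  have h2 := (h1.mul_left g).add (h0.mul_left C)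
  rw [poissonMean_eq, show (∑' k : ℕ, s ^ k / (k.factorial : ℝ) * (g * k + C))
      = g * (s * Real.exp s) + C * Real.exp s from ?_]
  · rw [Real.exp_neg]
    have := (Real.exp_pos s).ne'
    field_simp
  · rw [← h2.tsum_eq]
    exact tsum_congr fun k => by ring

theorem affine_growth (g C : ℝ) (k : ℕ) : |g * k + C| ≤ (|g| + |C|) * 2 ^ k := by
  have h1 : (k : ℝ) ≤ 2 ^ k := by exact_mod_cast Nat.lt_two_pow_self.le
  have h2 : (1 : ℝ) ≤ 2 ^ k := one_le_pow₀ (by norm_num)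
  calc |g * k + C| ≤ |g * k| + |C| := abs_add_le _ _
    _ = |g| * k + |C| * 1 := by rw [abs_mul, Nat.abs_cast, mul_one]
    _ ≤ |g| * 2 ^ k + |C| * 2 ^ k := by gcongr
    _ = _ := by ring

theorem hasDerivAt_expSeries {a : ℕ → ℝ} {A B : ℝ} (ha : ∀ k, |a k| ≤ A * B ^ k) (s : ℝ) :
    HasDerivAt (fun s : ℝ => ∑' k : ℕ, s ^ k / (k.factorial : ℝ) * a k)
      (∑' k : ℕ, s ^ k / (k.factorial : ℝ) * a (k + 1)) s := by
  have hB : ∀ k, |a k| ≤ A * |B| ^ k := fun k => by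
    have hA : 0 ≤ A := by simpa using (abs_nonneg _).trans (ha 0)
    refine (ha k).trans (mul_le_mul_of_nonneg_left ?_ hA)
    rw [← abs_pow]
    exact le_abs_self _
  set R := |s| + 1
  have hR : 0 ≤ R := by positivity
  let g' : ℕ → ℝ → ℝ := fun k y => (k : ℝ) * y ^ (k - 1) / (k.factorial : ℝ) * a k
  let u : ℕ → ℝ := fun k => (k : ℝ) * R ^ (k - 1) / (k.factorial : ℝ) * (A * |B| ^ k)
  have hsucc : ∀ (k : ℕ) (y : ℝ), ((k + 1 : ℕ) : ℝ) * y ^ k / ((k + 1).factorial : ℝ)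
      = y ^ k / (k.factorial : ℝ) := fun k y => by
    rw [Nat.factorial_succ]
    have : (k.factorial : ℝ) ≠ 0 := by positivity
    push_cast
    field_simp
  have hu : Summable u := by
    rw [← summable_nat_add_iff 1]
    have h := (Real.summable_pow_div_factorial (R * |B|)).mul_left (A * |B|)
    refine h.congr fun k => ?_
    simp only [u, Nat.add_sub_cancel, hsucc]
    ring_nf
  have key := hasDerivAt_tsum_of_isPreconnected (g := fun (k : ℕ) (y : ℝ) =>
      y ^ k / (k.factorial : ℝ) * a k) (g' := g') (t := Metric.ball 0 R) (y₀ := s) (y := s)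
    hu Metric.isOpen_ball (convex_ball 0 R).isPreconnected
    (fun k y _ => ((hasDerivAt_pow k y).div_const _).mul_const _)
    (fun k y hy => by
      have hy' : |y| ≤ R := by simpa using (mem_ball_zero_iff.1 hy).le
      simp only [g', u, Real.norm_eq_abs, abs_mul, abs_div, abs_pow, Nat.abs_cast]
      have := hB k
      gcongr)
    (by simp [R]) (summable_pow_div_factorial_mul ha s) (by simp [R])
  have hg' : Summable fun k => g' k s := by
    refine Summable.of_norm_bounded hu fun k => ?_
    simp only [g', u, Real.norm_eq_abs, abs_mul, abs_div, abs_pow, Nat.abs_cast]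
    have := hB k
    have : |s| ≤ R := by simp [R]
    gcongr
  refine key.congr_deriv ?_
  rw [hg'.tsum_eq_zero_add]
  simp only [g', Nat.cast_zero, zero_mul, zero_div, zero_add, Nat.add_sub_cancel, hsucc]

theorem partialSum_growth {a : ℕ → ℝ} {A : ℝ} (ha : ∀ k, |a k| ≤ A * 2 ^ k) (k : ℕ) :
    |∑ j ∈ Finset.range k, a j| ≤ A * 2 ^ k := by
  have hA : 0 ≤ A := by simpa using (abs_nonneg _).trans (ha 0)
  induction k with
  | zero => simpa using hA
  | succ k ih =>
    rw [Finset.sum_range_succ, pow_succ]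
    have := abs_add_le (∑ j ∈ Finset.range k, a j) (a k)
    linarith [ha k]

/-- The integral of the Poisson means of a sequence is the Poisson mean of its partial sums. -/
theorem integral_poissonMean {a : ℕ → ℝ} {A c : ℝ} (ha : ∀ k, |a k| ≤ A * 2 ^ k) (hc : 0 < c)
    (T : ℝ) : ∫ t in (0 : ℝ)..T, poissonMean a (c * t) =
      poissonMean (fun k => ∑ j ∈ Finset.range k, a j) (c * T) / c := by
  set S : ℕ → ℝ := fun k => ∑ j ∈ Finset.range k, a j with hS
  have hSg : ∀ k, |S k| ≤ A * 2 ^ k := partialSum_growth ha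
  have hS' : ∀ k, |S (k + 1)| ≤ (A * 2) * 2 ^ k := fun k => (hSg (k + 1)).trans_eq (by ring)
  have hder : ∀ t : ℝ, HasDerivAt (fun t => poissonMean S (c * t) / c)
      (poissonMean a (c * t)) t := fun t => by
    have h1 : HasDerivAt (fun t : ℝ => c * t) c t := by simpa using (hasDerivAt_id t).const_mul c
    have h2 := ((hasDerivAt_expSeries hSg (c * t)).comp t h1)
    have h3 := ((h1.neg.exp).mul h2).div_const c
    have heq : (fun t => poissonMean S (c * t) / c) = fun t => ((fun t => Real.exp (-(c * t))) *
        ((fun s : ℝ => ∑' k : ℕ, s ^ k / (k.factorial : ℝ) * S k) ∘ fun t => c * t)) t / c := by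
      funext t
      simp [poissonMean_eq]
    rw [heq]
    refine h3.congr_deriv ?_
    -- Differentiating a Poisson mean in its parameter gives the Poisson mean of the forward
    -- difference, and the forward difference of the partial sums is `a`.
    have h4 : (∑' k : ℕ, (c * t) ^ k / (k.factorial : ℝ) * a k)
        = (∑' k : ℕ, (c * t) ^ k / (k.factorial : ℝ) * S (k + 1))
          - ∑' k : ℕ, (c * t) ^ k / (k.factorial : ℝ) * S k := by
      rw [← (summable_pow_div_factorial_mul hS' _).tsum_sub
        (summable_pow_div_factorial_mul hSg _)]
      refine tsum_congr fun k => ?_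
      simp only [hS, Finset.sum_range_succ]
      ring
    rw [poissonMean_eq, h4]
    simp only [Function.comp, Pi.neg_apply]
    field_simp
    ring
  have hcont : Continuous fun t => poissonMean a (c * t) := by
    have h1 : Continuous fun s : ℝ => ∑' k : ℕ, s ^ k / (k.factorial : ℝ) * a k :=
      continuous_iff_continuousAt.2 fun s => (hasDerivAt_expSeries ha s).continuousAt
    simp only [poissonMean_eq]
    exact (by fun_prop : Continuous fun t => Real.exp (-(c * t))).mul
      (h1.comp (continuous_const.mul continuous_id))
  rw [intervalIntegral.integral_eq_sub_of_hasDerivAt (fun t _ => hder t)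
    (hcont.intervalIntegrable _ _)]
  have h0 : poissonMean S (c * 0) = 0 := by
    rw [poissonMean, mul_zero]
    refine (tsum_congr fun k => ?_).trans tsum_zero
    rcases k with _ | k
    · simp [hS]
    · simp
  rw [h0]
  simp

namespace Model

variable (M : Model)

theorem abs_revenue_le {x : ℝ} (hx : x ∈ Icc 0 M.Lam) : |M.revenue x| ≤ M.maxRevenue := by
  rw [abs_of_nonneg (M.revenue_nonneg hx)]
  exact M.revenue_le_max hx

end Model

/-! ### Rewards of a fixed policy: from ticks to long-run averages -/

namespace Policy

variable {M : Model} (P : Policy M)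

/-- A state in which the policy holds. -/
def Settled (x : ℕ × ℕ) : Prop := x.1 ≤ M.L ∧ P.dispatch x.1 x.2 = 0

theorem lt_of_dispatch {l m : ℕ} (hl : l ≤ M.L) (h : P.dispatch l m = 1) : l < M.L := by
  refine lt_of_le_of_ne hl ?_
  rintro rfl
  simp [P.dispatch_no_driver m] at h

theorem settled_settle (m : ℕ) : ∀ {l : ℕ}, l ≤ M.L → P.Settled (settle P.dispatch l m) := by
  induction m with
  | zero => exact fun {l} hl => by simpa [settle, Settled, P.dispatch_no_rider] using hl
  | succ m ih =>
    intro l hl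
    rw [settle]
    split_ifs with h
    · exact ih (P.lt_of_dispatch hl h)
    · exact ⟨hl, by simp only; omega⟩

theorem settle_add (φ : ℕ → ℕ → Fin 2) (m : ℕ) :
    ∀ l : ℕ, (settle φ l m).1 + (settle φ l m).2 = l + m := by
  induction m with
  | zero => exact fun l => by simp [settle]
  | succ m ih =>
    intro l
    rw [settle]
    split_ifs with h
    · rw [ih]; omega
    · rfl

theorem apply_settle_le {u : ℕ × ℕ → ℝ} (hu : ∀ l m, l < M.L → u (l + 1, m) ≤ u (l, m + 1))
    (m : ℕ) : ∀ {l : ℕ}, l ≤ M.L → u (settle P.dispatch l m) ≤ u (l, m) := by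
  induction m with
  | zero => exact fun {l} _ => by simp [settle]
  | succ m ih =>
    intro l hl
    rw [settle]
    split_ifs with h
    · exact (ih (P.lt_of_dispatch hl h)).trans (hu l m (P.lt_of_dispatch hl h))
    · exact le_rfl

theorem apply_settle_eq {u : ℕ × ℕ → ℝ} (hu : ∀ l m, l < M.L → P.dispatch l (m + 1) = 1 →
    u (l + 1, m) = u (l, m + 1))
    (m : ℕ) : ∀ {l : ℕ}, l ≤ M.L → u (settle P.dispatch l m) = u (l, m) := by
  induction m with
  | zero => exact fun {l} _ => by simp [settle]
  | succ m ih =>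
    intro l hl
    rw [settle]
    split_ifs with h
    · exact (ih (P.lt_of_dispatch hl h)).trans (hu l m (P.lt_of_dispatch hl h) h)
    · rfl

theorem step_eq (f : ℕ × ℕ → ℝ) (x : ℕ × ℕ) :
    P.step f x = (M.clock - P.rate x.1 x.2 - M.totalRate x.1 x.2) / M.clock * f x
      + P.rate x.1 x.2 / M.clock * f (settle P.dispatch x.1 (x.2 + 1))
      + M.totalRate x.1 x.2 / M.clock * f (settle P.dispatch (x.1 - 1) x.2) := by
  have := M.clock_pos.ne'
  unfold step
  field_simp
  ring

theorem clock_mul_step_sub (f : ℕ × ℕ → ℝ) (x : ℕ × ℕ) :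
    M.clock * (P.step f x - f x) =
      P.rate x.1 x.2 * (f (settle P.dispatch x.1 (x.2 + 1)) - f x)
      + M.totalRate x.1 x.2 * (f (settle P.dispatch (x.1 - 1) x.2) - f x) := by
  have := M.clock_pos.ne'
  unfold step
  field_simp
  ring

theorem step_weights_nonneg {x : ℕ × ℕ} (hx : x.1 ≤ M.L) :
    0 ≤ (M.clock - P.rate x.1 x.2 - M.totalRate x.1 x.2) / M.clock ∧
      0 ≤ P.rate x.1 x.2 / M.clock ∧ 0 ≤ M.totalRate x.1 x.2 / M.clock := by
  have h1 := P.rate_mem x.1 x.2 hx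
  have h2 := M.totalRate_le x.2 hx
  refine ⟨div_nonneg ?_ M.clock_pos.le, div_nonneg h1.1 M.clock_pos.le,
    div_nonneg (M.totalRate_nonneg _ hx) M.clock_pos.le⟩
  rw [M.clock_eq]
  linarith [h1.2]

/-- The new state is a convex combination of settled states, so functions need only be compared
there. -/
theorem step_mono {f f' : ℕ × ℕ → ℝ} (h : ∀ y, P.Settled y → f y ≤ f' y) {x : ℕ × ℕ}
    (hx : P.Settled x) : P.step f x ≤ P.step f' x := by
  obtain ⟨h1, h2, h3⟩ := P.step_weights_nonneg hx.1
  have ha := h _ (P.settled_settle (x.2 + 1) hx.1)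
  have hb := h _ (P.settled_settle x.2 ((Nat.sub_le x.1 1).trans hx.1))
  have hc := h _ hx
  rw [step_eq, step_eq]
  gcongr

theorem step_sum (F : ℕ → ℕ × ℕ → ℝ) (s : Finset ℕ) (x : ℕ × ℕ) :
    P.step (fun y => ∑ j ∈ s, F j y) x = ∑ j ∈ s, P.step (F j) x := by
  simp only [step_eq, Finset.sum_add_distrib, Finset.mul_sum]

theorem step_affine (f f' : ℕ × ℕ → ℝ) (a b c : ℝ) (x : ℕ × ℕ) :
    P.step (fun y => a + b * f y + c * f' y) x = a + b * P.step f x + c * P.step f' x := by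
  unfold step
  ring

theorem sum_step_succ (f : ℕ × ℕ → ℝ) (k : ℕ) (x : ℕ × ℕ) :
    ∑ j ∈ Finset.range (k + 1), (P.step^[j] f) x =
      f x + P.step (fun y => ∑ j ∈ Finset.range k, (P.step^[j] f) y) x := by
  rw [Finset.sum_range_succ', step_sum, add_comm]
  simp only [Function.iterate_succ_apply', Function.iterate_zero, id]

/-- A potential argument: the drift of `u` telescopes and leaves only a boundary term, which the
lower bound `B` controls. The gain `g` is a superharmonic function rather than a constant, which the
model without drivers needs. -/
theorem sum_step_le {f u g : ℕ × ℕ → ℝ} {B : ℝ} (hB : ∀ x, P.Settled x → B ≤ u x)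
    (hg : ∀ x, P.Settled x → P.step g x ≤ g x)
    (h : ∀ x, P.Settled x → f x + M.clock * (P.step u x - u x) ≤ g x) (k : ℕ) :
    ∀ x, P.Settled x →
      ∑ j ∈ Finset.range k, (P.step^[j] f) x ≤ g x * k + M.clock * (u x - B) := by
  induction k with
  | zero =>
    intro x hx
    simpa using mul_nonneg M.clock_pos.le (sub_nonneg.2 (hB x hx))
  | succ k ih =>
    intro x hx
    rw [sum_step_succ]
    have h1 := P.step_mono (f' := fun y => -(M.clock * B) + k * g y + M.clock * u y)
      (fun y hy => (ih y hy).trans_eq (by ring)) hx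
    rw [step_affine] at h1
    have h2 := h x hx
    have h3 := mul_le_mul_of_nonneg_left (hg x hx) k.cast_nonneg (α := ℝ)
    push_cast
    linarith

/-- The mirror image: here the potential has to be bounded above only. -/
theorem le_sum_step {f u g : ℕ × ℕ → ℝ} {B : ℝ} (hB : ∀ x, P.Settled x → u x ≤ B)
    (hg : ∀ x, P.Settled x → g x ≤ P.step g x)
    (h : ∀ x, P.Settled x → g x ≤ f x + M.clock * (P.step u x - u x)) (k : ℕ) :
    ∀ x, P.Settled x →
      g x * k + M.clock * (u x - B) ≤ ∑ j ∈ Finset.range k, (P.step^[j] f) x := by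
  induction k with
  | zero =>
    intro x hx
    simpa using mul_nonpos_of_nonneg_of_nonpos M.clock_pos.le (sub_nonpos.2 (hB x hx))
  | succ k ih =>
    intro x hx
    rw [sum_step_succ]
    have h1 := P.step_mono (f := fun y => -(M.clock * B) + k * g y + M.clock * u y)
      (fun y hy => le_trans (by linarith) (ih y hy)) hx
    rw [step_affine] at h1
    have h2 := h x hx
    have h3 := mul_le_mul_of_nonneg_left (hg x hx) k.cast_nonneg (α := ℝ)
    push_cast
    linarith

theorem reward_eq (x : ℕ × ℕ) :
    P.reward x = M.revenue (P.rate x.1 x.2) - (M.cd * x.1 + M.cr * x.2) := by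
  simp only [reward, Model.revenue]
  ring

theorem abs_reward_le {x : ℕ × ℕ} (hx : P.Settled x) :
    |P.reward x| ≤ (M.maxRevenue + |M.cd| + |M.cr|) * (1 + x.1 + x.2) := by
  have h1 := M.abs_revenue_le (P.rate_mem x.1 x.2 hx.1)
  have h2 : |M.cd * x.1 + M.cr * x.2| ≤ |M.cd| * x.1 + |M.cr| * x.2 := by
    refine (abs_add_le _ _).trans_eq ?_
    rw [abs_mul, abs_mul, Nat.abs_cast, Nat.abs_cast]
  rw [reward_eq]
  refine (abs_sub _ _).trans ((add_le_add h1 h2).trans ?_)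
  have hR := M.maxRevenue_nonneg
  have e : (M.maxRevenue + |M.cd| + |M.cr|) * (1 + x.1 + x.2)
      = (M.maxRevenue + (|M.cd| * x.1 + |M.cr| * x.2)) + (M.maxRevenue * (x.1 + x.2)
        + |M.cd| * (1 + x.2) + |M.cr| * (1 + x.1)) := by ring
  rw [e]
  exact le_add_of_nonneg_right (by positivity)

/-- One tick raises `l + m` by at most one, which at most doubles `1 + l + m`. Geometric growth is
crude, but it makes all the Poisson series converge. -/
theorem abs_iterate_step_le {f : ℕ × ℕ → ℝ} {A : ℝ}
    (hf : ∀ x, P.Settled x → |f x| ≤ A * (1 + x.1 + x.2)) (k : ℕ) :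
    ∀ x, P.Settled x → |(P.step^[k] f) x| ≤ A * (1 + x.1 + x.2) * 2 ^ k := by
  induction k with
  | zero => simpa using hf
  | succ k ih =>
    intro x hx
    rw [Function.iterate_succ_apply', step_eq]
    obtain ⟨h1, h2, h3⟩ := P.step_weights_nonneg hx.1
    set F := P.step^[k] f
    have hA : 0 ≤ A := by
      have := (abs_nonneg _).trans (hf x hx)
      by_contra! hneg
      have h' : (0 : ℝ) < 1 + x.1 + x.2 := by positivity
      linarith [mul_neg_of_neg_of_pos hneg h']
    have hbound : ∀ y : ℕ × ℕ, P.Settled y → y.1 + y.2 ≤ x.1 + x.2 + 1 →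
        |F y| ≤ A * (1 + x.1 + x.2) * 2 ^ (k + 1) := fun y hy hsum => by
      refine (ih y hy).trans ?_
      have h' : (y.1 : ℝ) + y.2 ≤ x.1 + x.2 + 1 := by exact_mod_cast hsum
      have h'' : (1 : ℝ) + y.1 + y.2 ≤ (1 + x.1 + x.2) * 2 := by
        have : (0 : ℝ) ≤ x.1 + x.2 := by positivity
        linarith
      rw [pow_succ]
      calc _ ≤ A * ((1 + x.1 + x.2) * 2) * 2 ^ k := by gcongr
        _ = _ := by ring
    have ha := hbound _ (P.settled_settle (x.2 + 1) hx.1) (by rw [settle_add]; omega)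
    have hb := hbound _ (P.settled_settle x.2 ((Nat.sub_le x.1 1).trans hx.1))
      (by rw [settle_add]; omega)
    have hc := hbound _ hx (by omega)
    set D := A * (1 + x.1 + x.2) * 2 ^ (k + 1)
    have hsum : (M.clock - P.rate x.1 x.2 - M.totalRate x.1 x.2) / M.clock
        + P.rate x.1 x.2 / M.clock + M.totalRate x.1 x.2 / M.clock = 1 := by
      have := M.clock_pos.ne'
      field_simp
      ring
    refine (abs_add_three _ _ _).trans ?_
    rw [abs_mul, abs_mul, abs_mul, abs_of_nonneg h1, abs_of_nonneg h2, abs_of_nonneg h3]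
    calc _ ≤ (M.clock - P.rate x.1 x.2 - M.totalRate x.1 x.2) / M.clock * D
        + P.rate x.1 x.2 / M.clock * D + M.totalRate x.1 x.2 / M.clock * D := by gcongr
      _ = _ := by rw [← add_mul, ← add_mul, hsum, one_mul]

theorem avgReward_eq {l m : ℕ} (hl : l ≤ M.L) (T : ℝ) : P.avgReward T l m =
    poissonMean (fun k => ∑ j ∈ Finset.range k, (P.step^[j] P.reward) (settle P.dispatch l m))
      (M.clock * T) / M.clock / T := by
  rw [avgReward, ← integral_poissonMean (P.abs_iterate_step_le (fun x hx => P.abs_reward_le hx) ·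
    _ (P.settled_settle m hl)) M.clock_pos]
  rfl

theorem avgReward_le {l m : ℕ} (hl : l ≤ M.L) {g C : ℝ}
    (h : ∀ k : ℕ, ∑ j ∈ Finset.range k, (P.step^[j] P.reward) (settle P.dispatch l m) ≤ g * k + C)
    {T : ℝ} (hT : 0 < T) : P.avgReward T l m ≤ g + C / M.clock / T := by
  have hc := M.clock_pos
  rw [P.avgReward_eq hl]
  have h1 := poissonMean_mono (partialSum_growth (P.abs_iterate_step_le
    (fun x hx => P.abs_reward_le hx) · _ (P.settled_settle m hl))) (affine_growth g C) h
    (mul_pos hc hT).le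
  rw [poissonMean_affine] at h1
  rw [div_div, div_le_iff₀ (mul_pos hc hT)]
  refine h1.trans_eq ?_
  field_simp

theorem le_avgReward {l m : ℕ} (hl : l ≤ M.L) {g C : ℝ}
    (h : ∀ k : ℕ, g * k + C ≤ ∑ j ∈ Finset.range k, (P.step^[j] P.reward) (settle P.dispatch l m))
    {T : ℝ} (hT : 0 < T) : g + C / M.clock / T ≤ P.avgReward T l m := by
  have hc := M.clock_pos
  rw [P.avgReward_eq hl]
  have h1 := poissonMean_mono (affine_growth g C) (partialSum_growth (P.abs_iterate_step_le
    (fun x hx => P.abs_reward_le hx) · _ (P.settled_settle m hl))) h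
    (mul_pos hc hT).le
  rw [poissonMean_affine] at h1
  rw [div_div, div_div, le_div_iff₀ (mul_pos hc hT)]
  refine le_of_eq_of_le ?_ h1
  field_simp

theorem tendsto_affine_div (g C : ℝ) : Tendsto (fun T : ℝ => g + C / T) atTop (𝓝 g) := by
  simpa using tendsto_const_nhds.add (tendsto_id.const_div_atTop C)

theorem limsup_avgReward_le {l m : ℕ} (hl : l ≤ M.L) {g C : ℝ}
    (h : ∀ k : ℕ, ∑ j ∈ Finset.range k, (P.step^[j] P.reward) (settle P.dispatch l m) ≤ g * k + C) :
    limsup (fun T => ((P.avgReward T l m : ℝ) : EReal)) atTop ≤ (g : EReal) := by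
  have h1 := (continuous_coe_real_ereal.tendsto g).comp (tendsto_affine_div g (C / M.clock))
  rw [← h1.limsup_eq]
  refine limsup_le_limsup ?_
  filter_upwards [eventually_gt_atTop 0] with T hT
  exact EReal.coe_le_coe_iff.2 (P.avgReward_le hl h hT)

theorem tendsto_avgReward {l m : ℕ} (hl : l ≤ M.L) {g C : ℝ}
    (h : ∀ k : ℕ, g * k + C ≤ ∑ j ∈ Finset.range k, (P.step^[j] P.reward) (settle P.dispatch l m))
    (h' : limsup (fun T => ((P.avgReward T l m : ℝ) : EReal)) atTop ≤ (g : EReal)) :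
    Tendsto (fun T => P.avgReward T l m) atTop (𝓝 g) := by
  rw [← EReal.tendsto_coe]
  refine tendsto_of_le_liminf_of_limsup_le ?_ h'
  have h1 := (continuous_coe_real_ereal.tendsto g).comp (tendsto_affine_div g (C / M.clock))
  rw [← h1.liminf_eq]
  refine liminf_le_liminf ?_
  filter_upwards [eventually_gt_atTop 0] with T hT
  exact EReal.coe_le_coe_iff.2 (P.le_avgReward hl h hT)

end Policy

/-! ### The discounted problem with truncated penalty -/

namespace Model

variable (M : Model) (β K : ℝ)

/-- Penalty rate at a state, truncated at `K`. -/
def cost (l m : ℕ) : ℝ := min (M.cd * l + M.cr * m) K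

/-- Discounted value of holding at `(l, m)` until the next tick, with continuation value `V`. -/
def hold (V : ℕ → ℕ → ℝ) (l m : ℕ) : ℝ :=
  (M.arrivalValue (V l (m + 1)) (V l m) - M.cost K l m + M.totalRate l m * V (l - 1) m
    + (M.maxTotalRate - M.totalRate l m) * V l m) / (β + M.clock)

/-- Bellman operator: hold until the next tick, or dispatch if possible. -/
def bellman (V : ℕ → ℕ → ℝ) (l m : ℕ) : ℝ :=
  if l < M.L ∧ 0 < m then max (M.hold β K V l m) (V (l + 1) (m - 1)) else M.hold β K V l m

variable {β K}

theorem cost_nonneg (hcd : 0 ≤ M.cd) (hK : 0 ≤ K) (l m : ℕ) : 0 ≤ M.cost K l m :=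
  le_min (add_nonneg (mul_nonneg hcd l.cast_nonneg) (mul_nonneg M.wqr_pos.le m.cast_nonneg)) hK

theorem cost_le (l m : ℕ) : M.cost K l m ≤ M.cd * l + M.cr * m := min_le_left _ _

theorem cost_le_succ_left (hcd : 0 ≤ M.cd) (l m : ℕ) : M.cost K l m ≤ M.cost K (l + 1) m :=
  min_le_min_right _ (by push_cast; linarith)

theorem cost_le_cost_dispatch (h : M.cr ≤ M.cd) (l m : ℕ) :
    M.cost K l (m + 1) ≤ M.cost K (l + 1) m :=
  min_le_min_right _ (by push_cast; linarith)

theorem cost_dispatch_le_cost (h : M.cd ≤ M.cr) (l m : ℕ) :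
    M.cost K (l + 1) m ≤ M.cost K l (m + 1) :=
  min_le_min_right _ (by push_cast; linarith)

theorem hold_mono (hβ : 0 < β) {V V' : ℕ → ℕ → ℝ} (h : ∀ l ≤ M.L, ∀ m, V l m ≤ V' l m)
    {l : ℕ} (hl : l ≤ M.L) (m : ℕ) : M.hold β K V l m ≤ M.hold β K V' l m := by
  have hc := M.clock_pos
  have h1 := M.arrivalValue_mono (h l hl (m + 1)) (h l hl m)
  have h2 := mul_le_mul_of_nonneg_left (h (l - 1) ((Nat.sub_le l 1).trans hl) m)
    (M.totalRate_nonneg m hl)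
  have h3 := mul_le_mul_of_nonneg_left (h l hl m) (sub_nonneg.2 (M.totalRate_le m hl))
  exact div_le_div_of_nonneg_right (by linarith) (by linarith)

theorem bellman_mono (hβ : 0 < β) {V V' : ℕ → ℕ → ℝ} (h : ∀ l ≤ M.L, ∀ m, V l m ≤ V' l m)
    {l : ℕ} (hl : l ≤ M.L) (m : ℕ) : M.bellman β K V l m ≤ M.bellman β K V' l m := by
  unfold bellman
  split_ifs with hlm
  · exact max_le_max (M.hold_mono hβ h hl m) (h _ hlm.1 _)
  · exact M.hold_mono hβ h hl m

theorem hold_le_bellman (V : ℕ → ℕ → ℝ) (l m : ℕ) : M.hold β K V l m ≤ M.bellman β K V l m := by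
  unfold bellman
  split_ifs
  · exact le_max_left _ _
  · exact le_rfl

/-- No comparison of the two completion rates is needed: a tick from `l + 1` busy drivers ends at
best with `l`, and a tick from `l` ends at worst with `l`. Both completion terms are therefore
separated by `maxTotalRate * V l m`. -/
theorem hold_succ_left_le (hβ : 0 < β) (hcd : 0 ≤ M.cd) {V : ℕ → ℕ → ℝ}
    (hV : ∀ l m, l < M.L → V (l + 1) m ≤ V l m) {l : ℕ} (hl : l < M.L) (m : ℕ) :
    M.hold β K V (l + 1) m ≤ M.hold β K V l m := by
  have hc := M.clock_pos
  refine div_le_div_of_nonneg_right ?_ (by linarith)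
  have h1 := M.arrivalValue_mono (hV l (m + 1) hl) (hV l m hl)
  have h2 := M.cost_le_succ_left (K := K) hcd l m
  have hs := M.totalRate_nonneg m hl.le
  have hs' := M.totalRate_le m (show l + 1 ≤ M.L from hl)
  have hs0 := M.totalRate_nonneg m (show l + 1 ≤ M.L from hl)
  have hsl := M.totalRate_le m hl.le
  have hv := hV l m hl
  rw [Nat.add_sub_cancel]
  set s := M.totalRate l m
  set s' := M.totalRate (l + 1) m
  set B := M.maxTotalRate
  have key : s' * V l m + (B - s') * V (l + 1) m ≤ s * V (l - 1) m + (B - s) * V l m := by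
    have hv' : s * V l m ≤ s * V (l - 1) m := by
      rcases Nat.eq_zero_or_pos l with rfl | h0
      · simp
      · obtain ⟨k, rfl⟩ := Nat.exists_eq_succ_of_ne_zero h0.ne'
        exact mul_le_mul_of_nonneg_left (hV k m (by omega)) hs
    have := mul_le_mul_of_nonneg_left hv (sub_nonneg.2 hs')
    linarith
  linarith

theorem bellman_succ_left_le (hβ : 0 < β) (hcd : 0 ≤ M.cd) {V : ℕ → ℕ → ℝ}
    (hV : ∀ l m, l < M.L → V (l + 1) m ≤ V l m) {l : ℕ} (hl : l < M.L) (m : ℕ) :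
    M.bellman β K V (l + 1) m ≤ M.bellman β K V l m := by
  have h := M.hold_succ_left_le (K := K) hβ hcd hV hl m
  unfold bellman
  split_ifs with h1 h2 h2
  · exact max_le_max h (hV _ _ h1.1)
  · exact absurd ⟨hl, h1.2⟩ h2
  · exact h.trans (le_max_left _ _)
  · exact h

/-- Dispatching and then holding is no worse than holding if the dispatch does not lower the rate. -/
theorem hold_le_hold_dispatch (hM : M.DiminishingReturns) (hβ : 0 < β) (hcr : M.cd ≤ M.cr)
    {V : ℕ → ℕ → ℝ} (hV : ∀ l m, l < M.L → V (l + 1) m ≤ V l m)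
    (hV' : ∀ l m, M.IsType2 l (m + 1) → V l (m + 1) ≤ V (l + 1) m) {l m : ℕ}
    (h : M.IsType2 l (m + 1)) : M.hold β K V l (m + 1) ≤ M.hold β K V (l + 1) m := by
  have hc := M.clock_pos
  have hl := h.lt
  refine div_le_div_of_nonneg_right ?_ (by linarith)
  have h1 := M.arrivalValue_mono (hV' l (m + 1) (h.succ_right hM)) (hV' l m h)
  have h2 := M.cost_dispatch_le_cost (K := K) hcr l m
  have hss := (M.isType2_succ_iff hl).1 h
  have hs := M.totalRate_nonneg (m + 1) hl.le
  have hs' := M.totalRate_le m (show l + 1 ≤ M.L from hl)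
  have hv := hV' l m h
  have hv2 := hv.trans (hV l m hl)
  rw [Nat.add_sub_cancel]
  set s := M.totalRate l (m + 1)
  set s' := M.totalRate (l + 1) m
  set B := M.maxTotalRate
  -- Split the completion clock `B` into `s`, `s' - s` and `B - s'`: both systems complete a trip,
  -- only the dispatched one does, or neither does.
  have key : s * V (l - 1) (m + 1) + (B - s) * V l (m + 1)
      ≤ s' * V l m + (B - s') * V (l + 1) m := by
    have hv' : s * V (l - 1) (m + 1) ≤ s * V l m := by
      rcases Nat.eq_zero_or_pos l with rfl | h0
      · simp [s, totalRate_zero]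
      · obtain ⟨k, rfl⟩ := Nat.exists_eq_succ_of_ne_zero h0.ne'
        exact mul_le_mul_of_nonneg_left (hV' k m (h.of_succ_left hM)) hs
    have a1 := mul_le_mul_of_nonneg_left hv (sub_nonneg.2 hs')
    have a2 := mul_le_mul_of_nonneg_left hv2 (sub_nonneg.2 hss)
    linarith
  linarith

/-- Holding is no worse than dispatching and then holding if the dispatch lowers the rate. -/
theorem hold_dispatch_le_hold (hβ : 0 < β) (hcr : M.cr ≤ M.cd)
    {V : ℕ → ℕ → ℝ} (hV : ∀ l m, l < M.L → V (l + 1) m ≤ V l m)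
    (hV' : ∀ l m, l < M.L → V (l + 1) m ≤ V l (m + 1)) {l m : ℕ} (hl : l < M.L)
    (h : M.totalRate (l + 1) m < M.totalRate l (m + 1)) :
    M.hold β K V (l + 1) m ≤ M.hold β K V l (m + 1) := by
  have hc := M.clock_pos
  refine div_le_div_of_nonneg_right ?_ (by linarith)
  have h1 := M.arrivalValue_mono (hV' l (m + 1) hl) (hV' l m hl)
  have h2 := M.cost_le_cost_dispatch (K := K) hcr l m
  have hs0 := M.totalRate_nonneg m (show l + 1 ≤ M.L from hl)
  have hs := M.totalRate_le (m + 1) hl.le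
  -- A strict loss of rate needs a busy driver, since the total rate is zero without one.
  obtain ⟨k, rfl⟩ : ∃ k, l = k + 1 := by
    refine Nat.exists_eq_succ_of_ne_zero ?_
    rintro rfl
    rw [totalRate_zero] at h
    linarith
  have hv := hV' (k + 1) m hl
  have hv1 := hV' k m (by omega)
  have hv2 := (hV (k + 1) m hl).trans hv1
  rw [Nat.add_sub_cancel, Nat.add_sub_cancel]
  set s := M.totalRate (k + 1) (m + 1)
  set s' := M.totalRate (k + 1 + 1) m
  set B := M.maxTotalRate
  -- The clock now splits into `s'`, `s - s'` and `B - s`; on the middle part only the holding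
  -- system completes a trip.
  have key : s' * V (k + 1) m + (B - s') * V (k + 1 + 1) m
      ≤ s * V k (m + 1) + (B - s) * V (k + 1) (m + 1) := by
    have a0 := mul_le_mul_of_nonneg_left hv1 hs0
    have a1 := mul_le_mul_of_nonneg_left hv (sub_nonneg.2 hs)
    have a2 := mul_le_mul_of_nonneg_left hv2 (sub_nonneg.2 h.le)
    linarith
  linarith

/-- A fixed point of the Bellman operator with the bounds and the monotonicity in the number of
busy drivers that the value function of the discounted problem enjoys. -/
structure IsValue (β K : ℝ) (V : ℕ → ℕ → ℝ) : Prop where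
  eq_bellman : ∀ l m, l ≤ M.L → V l m = M.bellman β K V l m
  lower : ∀ l m, l ≤ M.L → -(K / β) ≤ V l m
  upper : ∀ l m, l ≤ M.L → V l m ≤ M.maxRevenue / β
  succ_left_le : ∀ l m, l < M.L → V (l + 1) m ≤ V l m
  le_dispatch : M.cd ≤ M.cr → ∀ l m, M.IsType2 l (m + 1) → V l (m + 1) ≤ V (l + 1) m

/-- Value iteration. -/
def iter (β K : ℝ) (n : ℕ) : ℕ → ℕ → ℝ :=
  (M.bellman β K)^[n] fun l m => -(M.cost K l m / β)

theorem iter_succ (n : ℕ) : M.iter β K (n + 1) = M.bellman β K (M.iter β K n) :=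
  Function.iterate_succ_apply' _ _ _

/-- The starting function is a subsolution: one may hold and turn every rider away, and completions
then only reduce the penalty. -/
theorem iter_le_succ (hβ : 0 < β) (hcd : 0 ≤ M.cd) (n : ℕ) :
    ∀ l ≤ M.L, ∀ m, M.iter β K n l m ≤ M.iter β K (n + 1) l m := by
  have hc := M.clock_pos
  induction n with
  | zero =>
    intro l hl m
    rw [iter_succ]
    refine le_trans ?_ (M.hold_le_bellman _ _ _)
    simp only [iter, Function.iterate_zero, id, hold]
    rw [le_div_iff₀ (by linarith)]
    have h1 := M.Lam_mul_le_arrivalValue (-(M.cost K l (m + 1) / β)) (-(M.cost K l m / β))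
    have h2 : M.totalRate l m * -(M.cost K l m / β)
        ≤ M.totalRate l m * -(M.cost K (l - 1) m / β) := by
      rcases Nat.eq_zero_or_pos l with rfl | h0
      · simp
      · obtain ⟨k, rfl⟩ := Nat.exists_eq_succ_of_ne_zero h0.ne'
        refine mul_le_mul_of_nonneg_left (neg_le_neg ?_) (M.totalRate_nonneg _ hl)
        exact div_le_div_of_nonneg_right (M.cost_le_succ_left hcd k m) hβ.le
    have h3 : -(M.cost K l m / β) * (β + M.clock) = -M.cost K l m
        + (M.Lam + M.maxTotalRate) * -(M.cost K l m / β) := by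
      rw [M.clock_eq]
      field_simp
      ring
    linarith
  | succ n ih =>
    intro l hl m
    rw [iter_succ, M.iter_succ (n + 1)]
    exact M.bellman_mono hβ ih hl m

theorem hold_le_const (hβ : 0 < β) {V : ℕ → ℕ → ℝ} {C : ℝ}
    (h : ∀ l m, l ≤ M.L → V l m ≤ C) {l : ℕ} (hl : l ≤ M.L) (m : ℕ) :
    M.hold β K V l m ≤ (M.maxRevenue - M.cost K l m + M.clock * C) / (β + M.clock) := by
  have hc := M.clock_pos
  refine div_le_div_of_nonneg_right ?_ (by linarith)
  have h1 := M.arrivalValue_le _ _ _ (h l (m + 1) hl) (h l m hl)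
  have h3 := mul_le_mul_of_nonneg_left (h (l - 1) m ((Nat.sub_le l 1).trans hl))
    (M.totalRate_nonneg m hl)
  have h4 := mul_le_mul_of_nonneg_left (h l m hl) (sub_nonneg.2 (M.totalRate_le m hl))
  rw [M.clock_eq]
  linarith

theorem iter_le (hβ : 0 < β) (hcd : 0 ≤ M.cd) (hK : 0 ≤ K) (n : ℕ) :
    ∀ l m, l ≤ M.L → M.iter β K n l m ≤ M.maxRevenue / β := by
  have hc := M.clock_pos
  induction n with
  | zero =>
    intro l m _
    have h1 := div_nonneg (M.cost_nonneg hcd hK l m) hβ.le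
    have h2 := div_nonneg M.maxRevenue_nonneg hβ.le
    simp only [iter, Function.iterate_zero, id]
    linarith
  | succ n ih =>
    intro l m hl
    have h1 : M.hold β K (M.iter β K n) l m ≤ M.maxRevenue / β := by
      refine (M.hold_le_const hβ ih hl m).trans ?_
      rw [div_le_iff₀ (by linarith)]
      have h1 := M.cost_nonneg hcd hK l m
      have : M.maxRevenue / β * (β + M.clock) = M.maxRevenue + M.clock * (M.maxRevenue / β) := by
        field_simp
      linarith
    rw [iter_succ, bellman]
    split_ifs with h
    · exact max_le h1 (ih _ _ h.1)
    · exact h1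

theorem iter_succ_left_le (hβ : 0 < β) (hcd : 0 ≤ M.cd) (n : ℕ) :
    ∀ l m, l < M.L → M.iter β K n (l + 1) m ≤ M.iter β K n l m := by
  induction n with
  | zero =>
    intro l m _
    exact neg_le_neg (div_le_div_of_nonneg_right (M.cost_le_succ_left hcd l m) hβ.le)
  | succ n ih =>
    intro l m hl
    rw [iter_succ]
    exact M.bellman_succ_left_le hβ hcd ih hl m

/-- If the maximum at `(l, m + 1)` is attained by holding, the coupling applies. If it is attained
by dispatching, its value is the previous iterate at `(l + 1, m)`, which is why the iteration has to
be increasing. -/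
theorem iter_le_dispatch (hM : M.DiminishingReturns) (hβ : 0 < β) (hcd : 0 ≤ M.cd)
    (hcr : M.cd ≤ M.cr) (n : ℕ) :
    ∀ l m, M.IsType2 l (m + 1) → M.iter β K n l (m + 1) ≤ M.iter β K n (l + 1) m := by
  induction n with
  | zero =>
    intro l m _
    exact neg_le_neg (div_le_div_of_nonneg_right (M.cost_dispatch_le_cost hcr l m) hβ.le)
  | succ n ih =>
    intro l m h
    have h1 := (M.hold_le_hold_dispatch (K := K) hM hβ hcr (M.iter_succ_left_le hβ hcd n) ih h)
    have h2 := M.hold_le_bellman (β := β) (K := K) (M.iter β K n) (l + 1) m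
    have h3 := M.iter_le_succ (K := K) hβ hcd n (l + 1) h.lt m
    rw [iter_succ] at *
    rw [bellman, if_pos ⟨h.lt, Nat.succ_pos m⟩]
    exact max_le (h1.trans h2) h3

theorem tendsto_hold {ι : Type*} {F : Filter ι} {U : ι → ℕ → ℕ → ℝ} {V : ℕ → ℕ → ℝ}
    (h : ∀ l ≤ M.L, ∀ m, Tendsto (fun i => U i l m) F (𝓝 (V l m))) {l : ℕ} (hl : l ≤ M.L)
    (m : ℕ) : Tendsto (fun i => M.hold β K (U i) l m) F (𝓝 (M.hold β K V l m)) := by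
  have h1 := (M.continuous_arrivalValue.tendsto (V l (m + 1), V l m)).comp
    ((h l hl (m + 1)).prodMk_nhds (h l hl m))
  exact (((h1.sub_const _).add ((h (l - 1) ((Nat.sub_le l 1).trans hl) m).const_mul _)).add
    ((h l hl m).const_mul _)).div_const _

theorem exists_isValue (hM : M.DiminishingReturns) (hβ : 0 < β) (hcd : 0 ≤ M.cd) (hK : 0 ≤ K) :
    ∃ V, M.IsValue β K V := by
  let V : ℕ → ℕ → ℝ := fun l m => ⨆ n, M.iter β K n l m
  have hlim : ∀ l ≤ M.L, ∀ m, Tendsto (fun n => M.iter β K n l m) atTop (𝓝 (V l m)) :=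
    fun l hl m => tendsto_atTop_ciSup
      (monotone_nat_of_le_succ fun n => M.iter_le_succ hβ hcd n l hl m)
      ⟨M.maxRevenue / β, by rintro _ ⟨n, rfl⟩; exact M.iter_le hβ hcd hK n l m hl⟩
  refine ⟨V, ⟨fun l m hl => ?_, fun l m hl => ?_, fun l m hl => ?_, fun l m hl => ?_,
    fun hcr l m h => ?_⟩⟩
  · refine tendsto_nhds_unique ((tendsto_add_atTop_iff_nat 1).2 (hlim l hl m)) ?_
    simp only [iter_succ]
    unfold bellman
    split_ifs with h
    · exact (M.tendsto_hold hlim hl m).max (hlim _ h.1 _)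
    · exact M.tendsto_hold hlim hl m
  · refine le_trans ?_ ((monotone_nat_of_le_succ fun n => M.iter_le_succ hβ hcd n l hl m).ge_of_tendsto
      (hlim l hl m) 0)
    exact neg_le_neg (div_le_div_of_nonneg_right (min_le_right _ _) hβ.le)
  · exact le_of_tendsto' (hlim l hl m) fun n => M.iter_le hβ hcd hK n l m hl
  · exact le_of_tendsto_of_tendsto' (hlim _ hl m) (hlim l hl.le m)
      fun n => M.iter_succ_left_le hβ hcd n l m hl
  · exact le_of_tendsto_of_tendsto' (hlim l h.1 _) (hlim _ h.lt _)
      fun n => M.iter_le_dispatch hM hβ hcd hcr n l m h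

end Model

/-! ### Relative values: structure and bounds uniform in the discount -/

namespace Model

variable (M : Model)

/-- Optimal drift of `V` plus revenue when holding at `(l, m)`. -/
def drift (V : ℕ → ℕ → ℝ) (l m : ℕ) : ℝ :=
  M.arrivalValue (V l (m + 1)) (V l m) - M.Lam * V l m
    + M.totalRate l m * (V (l - 1) m - V l m)

theorem drift_sub_const (V : ℕ → ℕ → ℝ) (c : ℝ) (l m : ℕ) :
    M.drift (fun l m => V l m - c) l m = M.drift V l m := by
  simp only [drift, sub_eq_add_neg _ c, M.arrivalValue_add]
  ring

theorem tendsto_drift {ι : Type*} {F : Filter ι} {U : ι → ℕ → ℕ → ℝ} {V : ℕ → ℕ → ℝ}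
    (h : ∀ l ≤ M.L, ∀ m, Tendsto (fun i => U i l m) F (𝓝 (V l m))) {l : ℕ} (hl : l ≤ M.L)
    (m : ℕ) : Tendsto (fun i => M.drift (U i) l m) F (𝓝 (M.drift V l m)) := by
  have h1 := (M.continuous_arrivalValue.tendsto (V l (m + 1), V l m)).comp
    ((h l hl (m + 1)).prodMk_nhds (h l hl m))
  exact (h1.sub ((h l hl m).const_mul _)).add
    (((h (l - 1) ((Nat.sub_le l 1).trans hl) m).sub (h l hl m)).const_mul _)

variable {M} {β K : ℝ} {V : ℕ → ℕ → ℝ}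

theorem hold_mul (hβ : 0 < β) (l m : ℕ) :
    M.hold β K V l m * (β + M.clock) = M.drift V l m - M.cost K l m + M.clock * V l m := by
  have hc := M.clock_pos
  rw [hold, div_mul_cancel₀ _ (by linarith), drift, clock_eq]
  ring

namespace IsValue

variable (hV : M.IsValue β K V)
include hV

theorem hold_le {l m : ℕ} (hl : l ≤ M.L) : M.hold β K V l m ≤ V l m :=
  (M.hold_le_bellman V l m).trans_eq (hV.eq_bellman l m hl).symm

theorem dispatch_le {l m : ℕ} (hl : l < M.L) : V (l + 1) m ≤ V l (m + 1) := by
  rw [hV.eq_bellman l (m + 1) hl.le, bellman, if_pos ⟨hl, Nat.succ_pos m⟩]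
  exact le_max_right _ _

theorem eq_hold_or {l m : ℕ} (hl : l ≤ M.L) :
    V l m = M.hold β K V l m ∨ l < M.L ∧ 0 < m ∧ V l m = V (l + 1) (m - 1) := by
  have h := hV.eq_bellman l m hl
  rw [bellman] at h
  split_ifs at h with h1
  · rcases max_choice (M.hold β K V l m) (V (l + 1) (m - 1)) with h2 | h2
    · exact Or.inl (h.trans h2)
    · exact Or.inr ⟨h1.1, h1.2, h.trans h2⟩
  · exact Or.inl h

theorem drift_le (hβ : 0 < β) {l m : ℕ} (hl : l ≤ M.L) :
    M.drift V l m ≤ M.cost K l m + β * V l m := by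
  have hc := M.clock_pos
  have h := mul_le_mul_of_nonneg_right (hV.hold_le (m := m) hl) (by linarith : 0 ≤ β + M.clock)
  rw [hold_mul hβ] at h
  linarith

omit hV in
theorem drift_eq_of_eq_hold (hβ : 0 < β) {l m : ℕ} (h : V l m = M.hold β K V l m) :
    M.drift V l m = M.cost K l m + β * V l m := by
  have h := congrArg (· * (β + M.clock)) h
  simp only [hold_mul hβ] at h
  linarith

/-- Suppose that dispatching attains the value at a type 1 state. Closure of the type 2 region makes
the target type 1 as well, so by induction holding is optimal there, and the coupling shows that
holding before the dispatch is at least as good. -/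
theorem eq_hold_of_isType1 (hM : M.DiminishingReturns) (hβ : 0 < β) (hcr : M.cr ≤ M.cd) (m : ℕ) :
    ∀ l, M.IsType1 l m → V l m = M.hold β K V l m := by
  induction m with
  | zero =>
    intro l h
    exact (hV.eq_hold_or h.1).resolve_right fun h' => absurd h'.2.1 (lt_irrefl 0)
  | succ m ih =>
    intro l h
    rcases hV.eq_hold_or (m := m + 1) h.1 with h1 | ⟨hl, -, h1⟩
    · exact h1
    have hlt : M.totalRate (l + 1) m < M.totalRate l (m + 1) := by
      by_contra! hge
      exact ((M.isType2_succ_iff hl).2 hge).2 h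
    have h2 : M.IsType1 (l + 1) m := by
      by_contra hn
      exact (IsType2.succ_right hM (IsType2.of_succ_left hM ⟨hl, hn⟩)).2 h
    refine le_antisymm ?_ (hV.hold_le hl.le)
    rw [h1, Nat.add_sub_cancel, ih _ h2]
    exact M.hold_dispatch_le_hold hβ hcr hV.succ_left_le (fun _ _ => hV.dispatch_le) hl hlt

theorem eq_dispatch_of_isType2 (hcr : M.cd ≤ M.cr) {l m : ℕ} (h : M.IsType2 l m) :
    V l m = V (l + 1) (m - 1) := by
  obtain ⟨k, rfl⟩ := Nat.exists_eq_succ_of_ne_zero h.pos.ne'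
  exact le_antisymm (hV.le_dispatch hcr l k h) (hV.dispatch_le h.lt)

theorem beta_mul_le (hβ : 0 < β) {l m : ℕ} (hl : l ≤ M.L) : β * V l m ≤ M.maxRevenue := by
  have := mul_le_mul_of_nonneg_left (hV.upper l m hl) hβ.le
  rwa [mul_div_cancel₀ _ hβ.ne'] at this

/-- The empty system can turn every rider away at no penalty. -/
theorem zero_zero_nonneg (hβ : 0 < β) (hK : 0 ≤ K) : 0 ≤ V 0 0 := by
  have h := hV.drift_le hβ (m := 0) (Nat.zero_le _)
  have h1 := M.Lam_mul_le_arrivalValue (V 0 1) (V 0 0)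
  have h2 : M.cost K 0 0 = 0 := by simp [cost, hK]
  rw [drift, totalRate_zero, h2, zero_mul, zero_add, zero_add] at h
  by_contra! hn
  linarith [mul_neg_of_pos_of_neg hβ hn]

/-- Compare with turning riders away while holding: a completion occurs at a positive rate, so the
lost value is at most the forgone reward and penalty over the mean wait. The bound does not involve
`β` or `K`. -/
theorem le_succ_left (hβ : 0 < β) {l m : ℕ} (hl : l + 1 ≤ M.L) :
    V l m ≤ V (l + 1) m
      + (M.maxRevenue + (M.cd * (l + 1 : ℕ) + M.cr * m)) / M.totalRate (l + 1) m := by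
  have hs := M.totalRate_pos (m := m) (Nat.succ_pos l) hl
  have h := hV.drift_le hβ (m := m) hl
  have h1 := M.Lam_mul_le_arrivalValue (V (l + 1) (m + 1)) (V (l + 1) m)
  have h2 := M.cost_le (K := K) (l + 1) m
  have h3 := hV.beta_mul_le hβ (m := m) hl
  rw [drift, Nat.add_sub_cancel] at h
  rw [← sub_le_iff_le_add', le_div_iff₀ hs]
  linarith

/-- Compare with admitting every rider at `(0, m)`: the longer queue is reached at rate `Lam`. -/
theorem zero_succ_le (hβ : 0 < β) (m : ℕ) :
    V 0 (m + 1) ≤ V 0 m + (M.maxRevenue + M.cr * m) / M.Lam := by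
  have h := hV.drift_le hβ (m := m) (Nat.zero_le _)
  have h1 := M.Lam_mul_le_arrivalValue_left (V 0 (m + 1)) (V 0 m)
  have h2 := M.cost_le (K := K) 0 m
  have h3 := hV.beta_mul_le hβ (m := m) (Nat.zero_le _)
  rw [drift, totalRate_zero] at h
  rw [← sub_le_iff_le_add', le_div_iff₀ M.Lam_pos]
  push_cast at h2
  linarith

theorem le_zero {l m : ℕ} (hl : l ≤ M.L) : V l m ≤ V 0 m := by
  induction l with
  | zero => exact le_rfl
  | succ l ih => exact (hV.succ_left_le l m hl).trans (ih (by omega))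

end IsValue

variable (M) in
theorem exists_upper_bound (l m : ℕ) (hl : l ≤ M.L) : ∃ C, ∀ β K V, 0 < β → M.IsValue β K V →
    V l m - V 0 0 ≤ C := by
  suffices h : ∃ C, ∀ β K V, 0 < β → M.IsValue β K V → V 0 m - V 0 0 ≤ C by
    obtain ⟨C, hC⟩ := h
    exact ⟨C, fun β K V hβ hV => by linarith [hC β K V hβ hV, hV.le_zero (m := m) hl]⟩
  induction m with
  | zero => exact ⟨0, fun β K V _ _ => by simp⟩
  | succ m ih =>
    obtain ⟨C, hC⟩ := ih
    exact ⟨C + (M.maxRevenue + M.cr * m) / M.Lam, fun β K V hβ hV => by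
      linarith [hC β K V hβ hV, hV.zero_succ_le hβ m]⟩

-- A waiting rider can be removed by dispatching one driver and then completing the trip. This is
-- where a driver must exist.
variable (M) in
theorem exists_lower_bound (hL : 0 < M.L) (m : ℕ) : ∀ l ≤ M.L, ∃ C, ∀ β K V, 0 < β →
    M.IsValue β K V → V 0 0 - V l m ≤ C := by
  have aux : ∀ m, (∃ C, ∀ β K V, 0 < β → M.IsValue β K V → V 0 0 - V 0 m ≤ C) →
      ∀ l ≤ M.L, ∃ C, ∀ β K V, 0 < β → M.IsValue β K V → V 0 0 - V l m ≤ C := by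
    intro m h l
    induction l with
    | zero => exact fun _ => h
    | succ l ih =>
      intro hl
      obtain ⟨C, hC⟩ := ih (by omega)
      exact ⟨C + _, fun β K V hβ hV => by
        have h1 := hC β K V hβ hV
        have h2 := hV.le_succ_left hβ (m := m) hl
        rw [← sub_le_iff_le_add'] at h2
        calc V 0 0 - V (l + 1) m = (V 0 0 - V l m) + (V l m - V (l + 1) m) := by ring
          _ ≤ _ := add_le_add h1 h2⟩
  induction m with
  | zero => exact aux 0 ⟨0, fun β K V _ _ => by simp⟩
  | succ m ih =>
    obtain ⟨C, hC⟩ := ih 1 hL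
    exact aux (m + 1) ⟨C, fun β K V hβ hV => by
      linarith [hC β K V hβ hV, hV.dispatch_le (m := m) hL]⟩

-- Short queues form a finite set of states. In a long queue the penalty exceeds all possible
-- revenue, so holding contracts the value and dispatching shortens the queue; the supremum is thus
-- governed by the short queues.
variable (M) in
theorem exists_uniform_upper_bound (hcd : 0 ≤ M.cd) :
    ∃ C, ∀ β K V, 0 < β → M.maxRevenue ≤ K → M.IsValue β K V →
      ∀ l m, l ≤ M.L → V l m ≤ V 0 0 + C := by
  obtain ⟨N, hN⟩ := exists_nat_ge (M.maxRevenue / M.cr)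
  have hcr : 0 < M.cr := M.wqr_pos
  rw [div_le_iff₀ hcr] at hN
  have hfin : ∃ C : ℝ, 0 ≤ C ∧ ∀ β K V, 0 < β → M.IsValue β K V →
      ∀ l m, l ≤ M.L → m ≤ N → V l m - V 0 0 ≤ C := by
    have hC0 : ∀ p : ℕ × ℕ, ∃ C, p.1 ≤ M.L → ∀ β K V, 0 < β → M.IsValue β K V →
        V p.1 p.2 - V 0 0 ≤ C := fun p => by
      by_cases hp : p.1 ≤ M.L
      · obtain ⟨C, hC⟩ := M.exists_upper_bound p.1 p.2 hp
        exact ⟨C, fun _ => hC⟩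
      · exact ⟨0, fun h => absurd h hp⟩
    choose C hC using hC0
    refine ⟨∑ p ∈ Finset.range (M.L + 1) ×ˢ Finset.range (N + 1), |C p|,
      Finset.sum_nonneg fun _ _ => abs_nonneg _, fun β K V hβ hV l m hl hm => ?_⟩
    refine (hC (l, m) hl β K V hβ hV).trans ((le_abs_self _).trans ?_)
    exact Finset.single_le_sum (f := fun p => |C p|) (fun _ _ => abs_nonneg _)
      (by simp; omega)
  obtain ⟨C, hC0, hC⟩ := hfin
  refine ⟨C, fun β K V hβ hK hV l m hl => ?_⟩
  have hc := M.clock_pos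
  have hR := M.maxRevenue_nonneg
  -- Nonnegativity keeps `D` an upper bound after multiplication by the contraction factor `ρ`.
  have hD : 0 ≤ V 0 0 + C := add_nonneg (hV.zero_zero_nonneg hβ (hR.trans hK)) hC0
  set D := V 0 0 + C
  set ρ := M.clock / (β + M.clock)
  have hρ0 : 0 ≤ ρ := div_nonneg hc.le (by linarith)
  have hρ1 : ρ < 1 := by rw [div_lt_one (by linarith)]; linarith
  -- The outer induction gains a factor `ρ` when holding is optimal; the inner one on `m` follows a
  -- dispatch to a shorter queue.
  have key : ∀ k : ℕ, ∀ m l, l ≤ M.L → V l m ≤ max (ρ ^ k * (M.maxRevenue / β)) D := by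
    intro k
    induction k with
    | zero => exact fun m l hl => le_max_of_le_left (by simpa using hV.upper l m hl)
    | succ k ih =>
      intro m
      induction m with
      | zero =>
        intro l hl
        exact le_max_of_le_right (by linarith [hC β K V hβ hV l 0 hl (Nat.zero_le _)])
      | succ m ihm =>
        intro l hl
        by_cases hm : m + 1 ≤ N
        · exact le_max_of_le_right (by linarith [hC β K V hβ hV l (m + 1) hl hm])
        rcases hV.eq_hold_or (m := m + 1) hl with h | h
        · set S := max (ρ ^ k * (M.maxRevenue / β)) D
          have h1 := M.hold_le_const (K := K) hβ (fun l m hl => ih m l hl) hl (m + 1)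
          have h2 : M.maxRevenue ≤ M.cost K l (m + 1) := by
            refine le_min ?_ hK
            have hNm : (N : ℝ) ≤ (m + 1 : ℕ) := by exact_mod_cast (not_le.1 hm).le
            have := mul_le_mul_of_nonneg_right hNm hcr.le
            have := mul_nonneg hcd (Nat.cast_nonneg (α := ℝ) l)
            linarith
          calc V l (m + 1) ≤ (M.maxRevenue - M.cost K l (m + 1) + M.clock * S) / (β + M.clock) :=
                h.le.trans h1
            _ ≤ (M.clock * S) / (β + M.clock) :=
                div_le_div_of_nonneg_right (by linarith) (by linarith)
            _ = ρ * S := by rw [mul_div_right_comm]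
            _ = max (ρ * (ρ ^ k * (M.maxRevenue / β))) (ρ * D) := mul_max_of_nonneg _ _ hρ0
            _ ≤ _ := max_le_max (by rw [pow_succ]; linarith)
                (mul_le_of_le_one_left hD hρ1.le)
        · rw [h.2.2]
          exact ihm (l + 1) h.1
  have hlim : Tendsto (fun k : ℕ => max (ρ ^ k * (M.maxRevenue / β)) D) atTop (𝓝 (max 0 D)) := by
    simpa using ((tendsto_pow_atTop_nhds_zero_of_lt_one hρ0 hρ1).mul_const
      (M.maxRevenue / β)).max (tendsto_const_nhds (x := D))
  rw [max_eq_right hD] at hlim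
  exact ge_of_tendsto' hlim fun k => key k m l hl

/-- `V` serves as the potential. Truncation is what bounds it below for an arbitrary policy, and it
is harmless because the truncated penalty never exceeds the true one. -/
theorem IsValue.limsup_avgReward_le (hV : M.IsValue β K V) (hβ : 0 < β) {D : ℝ}
    (hD : ∀ l m, l ≤ M.L → V l m ≤ D) (Q : Policy M) {l m : ℕ} (hl : l ≤ M.L) :
    limsup (fun T => ((Q.avgReward T l m : ℝ) : EReal)) atTop ≤ ((β * D : ℝ) : EReal) := by
  refine Q.limsup_avgReward_le hl (C := _) fun k => Q.sum_step_le (g := fun _ => β * D)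
    (u := fun x => V x.1 x.2) (B := -(K / β)) (fun x hx => hV.lower _ _ hx.1)
    (fun x _ => by simp [Policy.step]) (fun x hx => ?_) k _ (Q.settled_settle m hl)
  have h1 := Q.apply_settle_le (u := fun x => V x.1 x.2) (fun l m hl => hV.dispatch_le hl) (x.2 + 1) hx.1
  have h2 := Q.apply_settle_le (u := fun x => V x.1 x.2) (fun l m hl => hV.dispatch_le hl) x.2 ((Nat.sub_le x.1 1).trans hx.1)
  have hr := Q.rate_mem x.1 x.2 hx.1
  have h3 := mul_le_mul_of_nonneg_left h1 hr.1
  have h4 := mul_le_mul_of_nonneg_left h2 (M.totalRate_nonneg x.2 hx.1)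
  have h5 := M.le_arrivalValue hr (V x.1 (x.2 + 1)) (V x.1 x.2)
  have h6 := hV.drift_le hβ (m := x.2) hx.1
  have h7 := mul_le_mul_of_nonneg_left (hD x.1 x.2 hx.1) hβ.le
  have h8 := M.cost_le (K := K) x.1 x.2
  rw [drift] at h6
  rw [Q.clock_mul_step_sub, Q.reward_eq]
  simp only at *
  linarith

end Model

/-! ### The vanishing-discount limit and greedy policies -/

namespace Model

variable (M : Model)

/-- A solution `(g, h)` of the average-reward optimality equation, with `h` bounded above, whose
gain `g` bounds the long-run average reward of every policy. -/
structure IsAverageSolution (g : ℝ) (h : ℕ → ℕ → ℝ) : Prop where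
  bddAbove : ∃ C, ∀ l m, l ≤ M.L → h l m ≤ C
  drift_or : ∀ l m, l ≤ M.L → M.drift h l m = g + (M.cd * l + M.cr * m) ∨
    l < M.L ∧ 0 < m ∧ h l m = h (l + 1) (m - 1)
  of_isType1 : M.cr ≤ M.cd → ∀ l m, M.IsType1 l m → M.drift h l m = g + (M.cd * l + M.cr * m)
  of_isType2 : M.cd ≤ M.cr → ∀ l m, M.IsType2 l m → h l m = h (l + 1) (m - 1)
  limsup_le : ∀ (Q : Policy M) (l m : ℕ), l ≤ M.L →
    limsup (fun T => ((Q.avgReward T l m : ℝ) : EReal)) atTop ≤ (g : EReal)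

theorem exists_tendsto_of_abs_le (F : Ultrafilter ℕ) {a : ℕ → ℝ} {C : ℝ} (h : ∀ i, |a i| ≤ C) :
    ∃ x, Tendsto a F (𝓝 x) := by
  have hF : ((F.map a : Ultrafilter ℝ) : Filter ℝ) ≤ 𝓟 (Icc (-C) C) := by
    rw [le_principal_iff, Ultrafilter.coe_map, mem_map]
    exact Eventually.of_forall fun i => abs_le.1 (h i)
  obtain ⟨x, -, hx⟩ := isCompact_Icc.ultrafilter_le_nhds (F.map a) hF
  exact ⟨x, hx⟩

/-- Only equations are kept for `h`. The bound on competing policies is taken from the discounted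
values before the limit, since `h` has no lower bound uniform over the states. -/
theorem exists_isAverageSolution (hM : M.DiminishingReturns) (hL : 0 < M.L) (hcd : 0 ≤ M.cd) :
    ∃ g h, M.IsAverageSolution g h := by
  have hR := M.maxRevenue_nonneg
  let β : ℕ → ℝ := fun i => 1 / ((i : ℝ) + 1)
  -- The offset meets the requirement of the uniform upper bound; the growth makes the truncation
  -- disappear eventually at each state.
  let K : ℕ → ℝ := fun i => M.maxRevenue + i
  have hβ : ∀ i, 0 < β i := fun i => Nat.one_div_pos_of_nat
  have hβ1 : ∀ i, β i ≤ 1 := fun i => by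
    have : (0 : ℝ) ≤ i := i.cast_nonneg
    exact (div_le_one (by positivity)).2 (by linarith)
  have hK : ∀ i, M.maxRevenue ≤ K i := fun i => le_add_of_nonneg_right i.cast_nonneg
  choose V hV using fun i => M.exists_isValue hM (hβ i) hcd (hR.trans (hK i))
  obtain ⟨C, hC⟩ := M.exists_uniform_upper_bound hcd
  -- An ultrafilter gives limits at all states at once and decides, at each state, which of holding
  -- and dispatching attains the maximum along it.
  let F : Ultrafilter ℕ := hyperfilter ℕ
  have hF : (F : Filter ℕ) ≤ atTop := Nat.hyperfilter_le_atTop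
  have hβ0 : Tendsto β F (𝓝 0) := tendsto_one_div_add_atTop_nhds_zero_nat.mono_left hF
  obtain ⟨g, hg⟩ := exists_tendsto_of_abs_le F (a := fun i => β i * V i 0 0)
    (C := M.maxRevenue) fun i => by
      rw [abs_of_nonneg (mul_nonneg (hβ i).le
        ((hV i).zero_zero_nonneg (hβ i) (hR.trans (hK i))))]
      exact (hV i).beta_mul_le (hβ i) (Nat.zero_le _)
  have hlim : ∀ l m, ∃ x, l ≤ M.L → Tendsto (fun i => V i l m - V i 0 0) F (𝓝 x) := fun l m => by
    by_cases hl : l ≤ M.L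
    · obtain ⟨A, hA⟩ := M.exists_lower_bound hL m l hl
      obtain ⟨x, hx⟩ := exists_tendsto_of_abs_le F (a := fun i => V i l m - V i 0 0)
        (C := max A C) fun i => by
          have h1 := hA _ _ _ (hβ i) (hV i)
          have h2 := hC _ _ _ (hβ i) (hK i) (hV i) l m hl
          have h3 := le_max_left A C
          have h4 := le_max_right A C
          exact abs_le.2 ⟨by linarith, by linarith⟩
      exact ⟨x, fun _ => hx⟩
    · exact ⟨0, fun h => absurd h hl⟩
  choose h hh using hlim
  have hdrift : ∀ l m, l ≤ M.L → Tendsto (fun i => M.drift (V i) l m) F (𝓝 (M.drift h l m)) :=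
    fun l m hl => by
      simpa only [drift_sub_const] using M.tendsto_drift
        (U := fun i l m => V i l m - V i 0 0) (fun l hl m => hh l m hl) hl m
  have hrhs : ∀ l m, l ≤ M.L → Tendsto (fun i => M.cost (K i) l m + β i * V i l m) F
      (𝓝 (g + (M.cd * l + M.cr * m))) := fun l m hl => by
    have h1 : Tendsto (fun i => M.cost (K i) l m) F (𝓝 (M.cd * l + M.cr * m)) := by
      refine tendsto_const_nhds.congr' (EventuallyEq.filter_mono ?_ hF)
      obtain ⟨N, hN⟩ := exists_nat_ge (M.cd * l + M.cr * m)
      filter_upwards [eventually_ge_atTop N] with i hi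
      have : (N : ℝ) ≤ i := by exact_mod_cast hi
      exact (min_eq_left (by simp only [K]; linarith)).symm
    -- Write `β i * V i l m` as `β i * V i 0 0` plus `β i` times a relative value; the second term
    -- vanishes in the limit.
    have h2 := (h1.add hg).add (hβ0.mul (hh l m hl))
    rw [zero_mul, add_zero, add_comm] at h2
    exact h2.congr fun i => by ring
  have hhold : ∀ l m, l ≤ M.L → (∀ᶠ i in F, V i l m = M.hold (β i) (K i) (V i) l m) →
      M.drift h l m = g + (M.cd * l + M.cr * m) := fun l m hl hev =>
    tendsto_nhds_unique_of_eventuallyEq (hdrift l m hl) (hrhs l m hl)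
      (hev.mono fun i hi => IsValue.drift_eq_of_eq_hold (hβ i) hi)
  have hdisp : ∀ l m, l < M.L → (∀ᶠ i in F, V i l m = V i (l + 1) (m - 1)) →
      h l m = h (l + 1) (m - 1) := fun l m hl hev =>
    tendsto_nhds_unique_of_eventuallyEq (hh l m hl.le) (hh (l + 1) (m - 1) hl)
      (hev.mono fun i hi => by simp only [hi])
  refine ⟨g, h, ⟨⟨C, fun l m hl => ?_⟩, fun l m hl => ?_, fun hcr l m ht => ?_,
    fun hcr l m ht => ?_, fun Q l m hl => ?_⟩⟩
  · exact le_of_tendsto' (hh l m hl) fun i => by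
      linarith [hC _ _ _ (hβ i) (hK i) (hV i) l m hl]
  · have hor : ∀ᶠ i in F, V i l m = M.hold (β i) (K i) (V i) l m ∨
        l < M.L ∧ 0 < m ∧ V i l m = V i (l + 1) (m - 1) :=
      Eventually.of_forall fun i => (hV i).eq_hold_or hl
    rcases Ultrafilter.eventually_or.1 hor with h1 | h1
    · exact Or.inl (hhold l m hl h1)
    · obtain ⟨i, hi⟩ := h1.exists
      exact Or.inr ⟨hi.1, hi.2.1, hdisp l m hi.1 (h1.mono fun i hi => hi.2.2)⟩
  · exact hhold l m ht.1 (Eventually.of_forall fun i =>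
      (hV i).eq_hold_of_isType1 hM (hβ i) hcr m l ht)
  · exact hdisp l m ht.lt (Eventually.of_forall fun i => (hV i).eq_dispatch_of_isType2 hcr ht)
  · have h1 : Tendsto (fun i => β i * (V i 0 0 + C)) F (𝓝 g) := by
      have := hg.add (hβ0.mul_const C)
      rw [zero_mul, add_zero] at this
      exact this.congr fun i => by ring
    exact ge_of_tendsto' ((continuous_coe_real_ereal.tendsto g).comp h1) fun i =>
      (hV i).limsup_avgReward_le (hβ i) (hC _ _ _ (hβ i) (hK i) (hV i)) Q hl

open Classical in
/-- The policy that prices optimally for the relative values `h` and dispatches, where possible,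
in the states satisfying `φ`. -/
def greedyPolicy (h : ℕ → ℕ → ℝ) (φ : ℕ → ℕ → Prop) : Policy M where
  rate l m := M.optRate (h l (m + 1)) (h l m)
  rate_mem l m _ := M.optRate_mem _ _
  dispatch l m := if l < M.L ∧ 0 < m ∧ φ l m then 1 else 0
  dispatch_no_rider l := by simp
  dispatch_no_driver m := by simp

variable {M}

theorem greedyPolicy_dispatch_eq_one {h : ℕ → ℕ → ℝ} {φ : ℕ → ℕ → Prop} {l m : ℕ} :
    (M.greedyPolicy h φ).dispatch l m = 1 ↔ l < M.L ∧ 0 < m ∧ φ l m := by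
  simp only [greedyPolicy]
  split_ifs with h1 <;> simp [h1]

theorem greedyPolicy_dispatch_eq_zero {h : ℕ → ℕ → ℝ} {φ : ℕ → ℕ → Prop} {l m : ℕ} :
    (M.greedyPolicy h φ).dispatch l m = 0 ↔ ¬ (l < M.L ∧ 0 < m ∧ φ l m) := by
  simp only [greedyPolicy]
  split_ifs with h1 <;> simp [h1]

/-- Dispatches preserve `h`, and at settled states the holding equation with the maximizing rate
makes reward plus drift equal `g` exactly. Any choice of dispatch states consistent with the two
equations is therefore optimal. -/
theorem IsAverageSolution.isOptimal_greedyPolicy {g : ℝ} {h : ℕ → ℕ → ℝ}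
    (H : M.IsAverageSolution g h) {φ : ℕ → ℕ → Prop}
    (hφ : ∀ l m, l < M.L → 0 < m → φ l m → h l m = h (l + 1) (m - 1))
    (hφ' : ∀ l m, l ≤ M.L → ¬ (l < M.L ∧ 0 < m ∧ φ l m) →
      M.drift h l m = g + (M.cd * l + M.cr * m)) :
    (M.greedyPolicy h φ).IsOptimal := by
  obtain ⟨C, hC⟩ := H.bddAbove
  refine ⟨fun _ _ => g, fun l m hl => ⟨?_, fun Q => H.limsup_le Q l m hl⟩⟩
  set P := M.greedyPolicy h φ
  have hu : ∀ (m : ℕ) {l : ℕ}, l ≤ M.L →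
      h (settle P.dispatch l m).1 (settle P.dispatch l m).2 = h l m :=
    P.apply_settle_eq (u := fun x => h x.1 x.2) fun l m hl hd =>
      (hφ l (m + 1) hl (Nat.succ_pos m) (greedyPolicy_dispatch_eq_one.1 hd).2.2).symm
  refine P.tendsto_avgReward hl (C := _) (fun k => P.le_sum_step (g := fun _ => g)
    (u := fun x => h x.1 x.2) (B := C) (fun x hx => hC _ _ hx.1)
    (fun x _ => by simp [Policy.step]) (fun x hx => ?_) k _ (P.settled_settle m hl))
    (H.limsup_le P l m hl)
  have h1 := hφ' x.1 x.2 hx.1 (greedyPolicy_dispatch_eq_zero.1 hx.2)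
  rw [P.clock_mul_step_sub, P.reward_eq, hu _ hx.1, hu _ ((Nat.sub_le x.1 1).trans hx.1)]
  rw [drift, arrivalValue] at h1
  simp only [P, greedyPolicy]
  linarith

theorem isZigzag_greedyPolicy_isType2 (hM : M.DiminishingReturns) (h : ℕ → ℕ → ℝ) :
    (M.greedyPolicy h M.IsType2).IsZigzag := by
  have key : ∀ {a b : Fin 2}, (a = 1 → b = 1) → a ≤ b := by decide
  constructor
  · refine fun l _ => monotone_nat_of_le_succ fun m => key fun h1 => ?_
    rw [greedyPolicy_dispatch_eq_one] at *
    exact ⟨h1.1, Nat.succ_pos m, h1.2.2.succ_right hM⟩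
  · intro m l _ l' _ hll
    refine key fun h1 => ?_
    simp only [greedyPolicy_dispatch_eq_one] at *
    induction hll with
    | refl => exact h1
    | step _ ih =>
      exact ih (by simp; exact (Nat.lt_of_succ_lt h1.1).le)
        ⟨Nat.lt_of_succ_lt h1.1, h1.2.1, h1.2.2.of_succ_left hM⟩

/-! ### The degenerate model without drivers -/

variable (M) in
/-- The policy that turns every rider away and never dispatches. -/
def idlePolicy : Policy M where
  rate _ _ := 0
  rate_mem _ _ _ := ⟨le_rfl, M.Lam_pos.le⟩
  dispatch _ _ := 0
  dispatch_no_rider _ := rfl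
  dispatch_no_driver _ := rfl

theorem settle_of_L_eq_zero (hL : M.L = 0) (Q : Policy M) (m : ℕ) :
    settle Q.dispatch 0 m = (0, m) := by
  have h := Q.dispatch_no_driver m
  rw [hL] at h
  cases m with
  | zero => rfl
  | succ m => rw [settle, h]; simp

theorem clock_mul_step_sub_of_L_eq_zero (hL : M.L = 0) (Q : Policy M) (f : ℕ × ℕ → ℝ) (m : ℕ) :
    M.clock * (Q.step f (0, m) - f (0, m)) = Q.rate 0 m * (f (0, m + 1) - f (0, m)) := by
  rw [Q.clock_mul_step_sub]
  simp only [totalRate_zero, settle_of_L_eq_zero hL]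
  ring

/-- Each admitted rider pays once and then waits forever, so admissions bring at most a bounded
total gain before the penalty outweighs the revenue. -/
theorem limsup_avgReward_le_of_L_eq_zero (hL : M.L = 0) (Q : Policy M) (m : ℕ) :
    limsup (fun T => ((Q.avgReward T 0 m : ℝ) : EReal)) atTop ≤ ((-(M.cr * m) : ℝ) : EReal) := by
  have hcr : 0 < M.cr := M.wqr_pos
  have hfare := M.maxFare_nonneg
  obtain ⟨N, hN⟩ := exists_nat_ge (M.maxRevenue / M.cr)
  rw [div_le_iff₀ hcr] at hN
  have hmin : ∀ n k : ℕ, ((min (n + 1) k : ℕ) : ℝ) - (min n k : ℕ) = if n < k then 1 else 0 := by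
    intro n k
    split_ifs with h
    · rw [min_eq_left h, min_eq_left h.le]; push_cast; ring
    · rw [min_eq_right (by omega), min_eq_right (by omega)]; ring
  have hx0 : ∀ x : ℕ × ℕ, Q.Settled x → ∃ n, x = (0, n) := fun x hx =>
    ⟨x.2, Prod.ext (by have := hx.1; simp only; omega) rfl⟩
  -- Below queue length `m + N` the potential falls by `maxFare` per admission and absorbs the fare.
  -- From there on it is constant, and the penalty of the `N` extra riders covers `maxRevenue`. The
  -- gain is cut off at `m`, so it equals the claimed value at the initial state.
  have key := fun k => Q.sum_step_le (f := Q.reward) (g := fun x => -(M.cr * (min x.2 m : ℕ)))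
    (u := fun x => -(M.maxFare * (min x.2 (m + N) : ℕ))) (B := -(M.maxFare * (m + N : ℕ)))
    (fun x _ => neg_le_neg (mul_le_mul_of_nonneg_left
      (by exact_mod_cast min_le_right _ _) hfare))
    (fun x hx => by
      obtain ⟨n, rfl⟩ := hx0 x hx
      have h1 := clock_mul_step_sub_of_L_eq_zero hL Q (fun x => -(M.cr * (min x.2 m : ℕ))) n
      have h2 := (Q.rate_mem 0 n (Nat.zero_le _)).1
      have h3 := hmin n m
      have h4 : (0 : ℝ) ≤ if n < m then 1 else 0 := by split_ifs <;> norm_num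
      rw [← h3] at h4
      have h5 := mul_nonneg h2 (mul_nonneg hcr.le h4)
      by_contra! hlt
      have h6 := mul_pos M.clock_pos (sub_pos.2 hlt)
      rw [h1] at h6
      simp only at h6
      linarith)
    (fun x hx => by
      obtain ⟨n, rfl⟩ := hx0 x hx
      rw [clock_mul_step_sub_of_L_eq_zero hL, Q.reward_eq]
      have hr := Q.rate_mem 0 n (Nat.zero_le _)
      have h1 := M.revenue_le hr
      have h2 := M.revenue_le_max hr
      have h3 := hmin n (m + N)
      simp only
      have h4 : -(M.maxFare * ((min (n + 1) (m + N) : ℕ) : ℝ)) - -(M.maxFare * (min n (m + N) : ℕ))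
          = -(M.maxFare * if n < m + N then 1 else 0) := by rw [← h3]; ring
      rw [h4]
      split_ifs with h
      · have : ((min n m : ℕ) : ℝ) ≤ n := by exact_mod_cast min_le_left _ _
        have := mul_le_mul_of_nonneg_left this hcr.le
        push_cast at *
        linarith
      · have h5 : (m : ℝ) + N ≤ n := by exact_mod_cast not_lt.1 h
        rw [min_eq_right (by omega)]
        have := mul_le_mul_of_nonneg_left h5 hcr.le
        push_cast at *
        linarith) k (0, m)
    (by simpa [settle_of_L_eq_zero hL] using Q.settled_settle m (Nat.zero_le M.L))
  simp only [min_self] at key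
  rw [← settle_of_L_eq_zero hL Q m] at key
  exact Q.limsup_avgReward_le (Nat.zero_le _) key

theorem isOptimal_idlePolicy (hL : M.L = 0) : M.idlePolicy.IsOptimal := by
  refine ⟨fun _ m => -(M.cr * m), fun l m hl => ?_⟩
  obtain rfl : l = 0 := by omega
  have hsup := fun Q : Policy M => limsup_avgReward_le_of_L_eq_zero hL Q m
  refine ⟨?_, hsup⟩
  have hstep : ∀ (f : ℕ × ℕ → ℝ) x, M.idlePolicy.Settled x → M.idlePolicy.step f x = f x :=
    fun f x hx => by
      have h0 : x.1 = 0 := by have := hx.1; omega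
      simp [Policy.step, idlePolicy, h0, totalRate_zero]
  refine M.idlePolicy.tendsto_avgReward hl (C := 0) (fun k => ?_) (hsup _)
  have h := M.idlePolicy.le_sum_step (f := M.idlePolicy.reward) (g := M.idlePolicy.reward)
    (u := fun _ => 0) (B := 0) (fun _ _ => le_rfl) (fun x hx => (hstep _ x hx).ge)
    (fun x hx => by rw [hstep _ x hx]; simp) k _ (M.idlePolicy.settled_settle m hl)
  rw [settle_of_L_eq_zero hL] at h ⊢
  have hr : M.idlePolicy.reward (0, m) = -(M.cr * m) := by
    simp [Policy.reward, idlePolicy]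
  rw [hr] at h
  simpa using h

end Model

end SpatialQueue

end

theorem theorem1 (M : SpatialQueue.Model) (hμ : M.DiminishingReturns) :
    (M.cd = M.cr → ∃ P : SpatialQueue.Policy M, P.IsOptimal ∧ P.IsZigzag ∧
      (∀ l m, M.IsType1 l m → P.dispatch l m = 0) ∧
      (∀ l m, M.IsType2 l m → P.dispatch l m = 1)) ∧
    (M.cr < M.cd → ∃ P : SpatialQueue.Policy M, P.IsOptimal ∧
      (∀ l m, M.IsType1 l m → P.dispatch l m = 0)) ∧
    (0 ≤ M.cd → M.cd < M.cr → ∃ P : SpatialQueue.Policy M, P.IsOptimal ∧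
      (∀ l m, M.IsType2 l m → P.dispatch l m = 1)) := by
  have hcr : 0 < M.cr := M.wqr_pos
  rcases Nat.eq_zero_or_pos M.L with hL | hL
  · have hopt := SpatialQueue.Model.isOptimal_idlePolicy hL
    have h2 : ∀ l m, M.IsType2 l m → M.idlePolicy.dispatch l m = 1 := fun l m h => by
      have := h.lt
      omega
    exact ⟨fun _ => ⟨_, hopt, ⟨fun _ _ => monotone_const, fun _ => antitoneOn_const⟩,
      fun _ _ _ => rfl, h2⟩, fun _ => ⟨_, hopt, fun _ _ _ => rfl⟩, fun _ _ => ⟨_, hopt, h2⟩⟩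
  refine ⟨fun hc => ?_, fun hc => ?_, fun hcd hc => ?_⟩
  · obtain ⟨g, h, H⟩ := M.exists_isAverageSolution hμ hL (hc ▸ hcr.le)
    refine ⟨M.greedyPolicy h M.IsType2, H.isOptimal_greedyPolicy
      (fun l m _ _ ht => H.of_isType2 hc.le l m ht) (fun l m hl hn => ?_),
      SpatialQueue.Model.isZigzag_greedyPolicy_isType2 hμ h, fun l m ht => ?_, fun l m ht => ?_⟩
    · refine H.of_isType1 hc.ge l m ?_
      by_contra ht
      have ht2 : M.IsType2 l m := ⟨hl, ht⟩
      exact hn ⟨ht2.lt, ht2.pos, ht2⟩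
    · exact SpatialQueue.Model.greedyPolicy_dispatch_eq_zero.2 fun h' => h'.2.2.2 ht
    · exact SpatialQueue.Model.greedyPolicy_dispatch_eq_one.2 ⟨ht.lt, ht.pos, ht⟩
  -- Ties are broken towards holding: dispatch only where the holding equation fails, which excludes
  -- type 1 states.
  · obtain ⟨g, h, H⟩ := M.exists_isAverageSolution hμ hL (hcr.trans hc).le
    refine ⟨M.greedyPolicy h fun l m => M.drift h l m ≠ g + (M.cd * l + M.cr * m),
      H.isOptimal_greedyPolicy (fun l m hl _ hn => ((H.drift_or l m hl.le).resolve_left hn).2.2)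
      (fun l m hl hn => ?_), fun l m ht => ?_⟩
    · by_contra hne
      have := (H.drift_or l m hl).resolve_left hne
      exact hn ⟨this.1, this.2.1, hne⟩
    · exact SpatialQueue.Model.greedyPolicy_dispatch_eq_zero.2
        fun h' => h'.2.2 (H.of_isType1 hc.le l m ht)
  -- Ties are broken towards dispatching: dispatch wherever it preserves `h`, which includes all
  -- type 2 states.
  · obtain ⟨g, h, H⟩ := M.exists_isAverageSolution hμ hL hcd
    refine ⟨M.greedyPolicy h fun l m => h l m = h (l + 1) (m - 1),
      H.isOptimal_greedyPolicy (fun l m _ _ he => he)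
      (fun l m hl hn => (H.drift_or l m hl).resolve_right hn), fun l m ht => ?_⟩
    exact SpatialQueue.Model.greedyPolicy_dispatch_eq_one.2
      ⟨ht.lt, ht.pos, H.of_isType2 hc.le l m ht⟩
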